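/- Let $k$ be a field of characteristic zero and let $P$ be an ordinary (one-colored, symmetric, unital) operad in $\mathbb Z$-graded $k$-vector spaces, regarded as a dg-operad with zero differential. Let $S$ be a finite category (a finite diagram) and let $D\subset S$ be a subcategory (a subdiagram). Let $P_{(S,\underline D)}$ be the colored operad, with the objects of $S$ as colors, that describes $S$-diagrams of (differential) graded vector spaces with a $P$-algebra structure at each vertex of $D$ such that each arrow of $D$ is a homomorphism of $P$-algebras. Explicitly, it is generated by a copy $p_v$ of each operation $p$ of $P$ for each vertex $v$ of $D$ and by each arrow of $S$ (as a unary operation of degree $0$), modulo the relations of the operad $P$ at each vertex of $D$, the identity and composition relations of $S$, and the relations $f\,p_v = p_w f^{\otimes n}$ for all arrows $f:v\to w$ of $D$ and all $n$-ary operations $p$ of $P$; its differential is zero. Put $P_{\underline S}:=P_{(S,\underline S)}$ and let $\phi: P_{(S,\underline D)}\to P_{\underline S}$ be the canonical map, which sends each generator to the generator of the same name. The pair $(S,D)$ has the classical $P$-extension property if there is a morphism of colored operads $\psi: P_{\underline S}\to P_{(S,\underline D)}$ with $\psi\circ\phi=\mathrm{id}$. A cofibration of colored dg-operads is a morphism which,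 up to isomorphism, has the form $(\mathcal S,\partial)\hookrightarrow(\mathcal S*\Gamma(E),\partial)$, where $\Gamma(E)$ is the free operad on a graded colored collection $E=\bigoplus_{i\ge 0}E_i$, $*$ is the coproduct of operads, and $\partial(E_i)\subset \mathcal S*\Gamma(\bigoplus_{j<i}E_j)$ for each $i\geq 0$; a colored dg-operad is cofibrant if it has the form $(\Gamma(E),\partial)$ with $E=\bigoplus_{i\ge 0} E_i$ and $\partial(E_i)\subset\Gamma(\bigoplus_{j<i}E_j)$ for each $i \geq 0$. Consider any commutative square of colored dg-operads $$\begin{array}{ccc} R_{(S,\underline D)} & \xrightarrow{\ \iota\ } & R_{\underline S}\\ {\scriptstyle\alpha_{(S,\underline D)}}\downarrow & & \downarrow{\scriptstyle\alpha_{\underline S}}\\ P_{(S,\underline D)} & \xrightarrow{\ \phi\ } & P_{\underline S}\end{array}$$ in which $\iota$ is a cofibration, $R_{(S,\underline D)}$ and $R_{\underline S}$ are cofibrant, and the vertical maps are homology isomorphisms. With respect to this choice of resolutions, $(S,D)$ has the homotopy $P$-extension property if there is a morphism of colored dg-operads $p: R_{\underline S}\to R_{(S,\underline D)}$ with $p\circ\iota=\mathrm{id}$.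 Theorem. For every such square, the pair $(S,D)$ has the homotopy $P$-extension property if and only if it has the classical $P$-extension property. -/

import Mathlib

open CategoryTheory

universe u w

/-! ### Colored symmetric operads in graded vector spaces

`obj n c a p` is the degree `p` part of the space of operations with `n` inputs of colors
`c 0, …, c (n - 1)` and output of color `a`. -/

/-- A `C`-colored collection of `ℤ`-graded `k`-vector spaces: for all colors a graded vector space,
with a right action of the symmetric groups permuting the input colors. -/
structure GrCollection (k : Type u) [Field k] (C : Type w) where
  obj : (n : ℕ) → (Fin n → C) → C → ℤ → Type u
  [acg : ∀ n c a p, AddCommGroup (obj n c a p)]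
  [mod : ∀ n c a p, Module k (obj n c a p)]
  /-- the right action `x ↦ x σ`; the input `i` of `x σ` is the input `σ i` of `x` -/
  act : ∀ {n : ℕ} {c c' : Fin n → C} {a : C} {p : ℤ} (σ : Equiv.Perm (Fin n)),
    (∀ i, c' i = c (σ i)) → (obj n c a p →ₗ[k] obj n c' a p)
  act_one : ∀ {n : ℕ} {c : Fin n → C} {a : C} {p : ℤ} (h : ∀ i, c i = c ((1 : Equiv.Perm (Fin n)) i))
    (x : obj n c a p), act 1 h x = x
  act_mul : ∀ {n : ℕ} {c c' c'' : Fin n → C} {a : C} {p : ℤ} (σ τ : Equiv.Perm (Fin n))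
    (h : ∀ i, c' i = c (σ i)) (h' : ∀ i, c'' i = c' (τ i)) (h'' : ∀ i, c'' i = c ((σ * τ) i))
    (x : obj n c a p), act τ h' (act σ h x) = act (σ * τ) h'' x

attribute [instance] GrCollection.acg GrCollection.mod

/-- A way to plug an operation with inputs `b` and output `a'` into one input (`slot`) of an
operation with inputs `c`, together with a numbering `num` of the inputs of the result, namely the
inputs of the first operation other than `slot` and all the inputs of the second one.
The classical partial composition `x ∘ᵢ y` uses the order in which the inputs of `y` are inserted
at the place `i`. -/
structure Graft {C : Type w} {m n l : ℕ} (c : Fin m → C) (b : Fin n → C) (a' : C)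
    (e : Fin l → C) where
  slot : Fin m
  slot_color : a' = c slot
  num : {j : Fin m // j ≠ slot} ⊕ Fin n ≃ Fin l
  num_color : ∀ s, e (num s) = Sum.elim (fun j => c j.1) b s

namespace Graft

variable {C : Type w} {m n o l l₁ l₃ : ℕ} {c c' : Fin m → C} {b b' : Fin n → C} {f : Fin o → C}
  {e e' : Fin l → C} {e₁ : Fin l₁ → C} {e₃ : Fin l₃ → C} {a₁ a₂ : C}

/-- the number that an input of the outer operation gets -/
def outer (g : Graft c b a₁ e) (j : Fin m) (hj : j ≠ g.slot) : Fin l := g.num (Sum.inl ⟨j, hj⟩)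

/-- the number that an input of the inner operation gets -/
def inner (g : Graft c b a₁ e) (t : Fin n) : Fin l := g.num (Sum.inr t)

/-- `g'` is `g` with the inputs of the result renumbered by `σ`. -/
structure RenumberResult (σ : Equiv.Perm (Fin l)) (g : Graft c b a₁ e) (g' : Graft c b a₁ e') :
    Prop where
  slot : g'.slot = g.slot
  outer : ∀ j hj hj', σ (g'.outer j hj') = g.outer j hj
  inner : ∀ t, σ (g'.inner t) = g.inner t

/-- `g'` is `g` with the inputs of the outer operation renumbered by `σ`. -/
structure RenumberOuter (σ : Equiv.Perm (Fin m)) (g : Graft c' b a₁ e) (g' : Graft c b a₁ e) :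
    Prop where
  slot : g'.slot = σ g.slot
  outer : ∀ j hj hj', g'.outer (σ j) hj' = g.outer j hj
  inner : ∀ t, g'.inner t = g.inner t

/-- `g'` is `g` with the inputs of the inner operation renumbered by `σ`. -/
structure RenumberInner (σ : Equiv.Perm (Fin n)) (g : Graft c b' a₁ e) (g' : Graft c b a₁ e) :
    Prop where
  slot : g'.slot = g.slot
  outer : ∀ j hj hj', g'.outer j hj' = g.outer j hj
  inner : ∀ t, g'.inner (σ t) = g.inner t

/-- `(x ∘ y) ∘ z`, with `z` plugged into an input of `y`, and `x ∘ (y ∘ z)` have the same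
numbering. -/
structure Sequential (g₁ : Graft c b a₁ e₁) (g₂ : Graft e₁ f a₂ e) (g₃ : Graft b f a₂ e₃)
    (g₄ : Graft c e₃ a₁ e) : Prop where
  slot₂ : g₂.slot = g₁.inner g₃.slot
  slot₄ : g₄.slot = g₁.slot
  num₁ : ∀ j hj hj' hj'', g₂.outer (g₁.outer j hj) hj' = g₄.outer j hj''
  num₂ : ∀ t ht ht', g₂.outer (g₁.inner t) ht' = g₄.inner (g₃.outer t ht)
  num₃ : ∀ v, g₂.inner v = g₄.inner (g₃.inner v)

/-- `(x ∘ y) ∘ z` and `(x ∘ z) ∘ y`, with `y` and `z` plugged into two different inputs of `x`,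
have the same numbering. -/
structure Parallel (g₁ : Graft c b a₁ e₁) (g₂ : Graft e₁ f a₂ e) (g₃ : Graft c f a₂ e₃)
    (g₄ : Graft e₃ b a₁ e) : Prop where
  ne : g₃.slot ≠ g₁.slot
  slot₂ : g₂.slot = g₁.outer g₃.slot ne
  slot₄ : g₄.slot = g₃.outer g₁.slot ne.symm
  num₁ : ∀ j h₁ h₂ h₃ h₄, g₂.outer (g₁.outer j h₁) h₂ = g₄.outer (g₃.outer j h₃) h₄
  num₂ : ∀ t ht, g₂.outer (g₁.inner t) ht = g₄.inner t
  num₃ : ∀ v hv, g₂.inner v = g₄.outer (g₃.inner v) hv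

end Graft

/-- A `C`-colored symmetric operad (with units) in graded `k`-vector spaces, described by its
partial compositions. -/
structure GrOperad (k : Type u) [Field k] (C : Type w) extends GrCollection k C where
  unit : ∀ a : C, obj 1 (fun _ => a) a 0
  comp : ∀ {m n l : ℕ} {c : Fin m → C} {b : Fin n → C} {e : Fin l → C} {a a' : C} {p q r : ℤ},
    Graft c b a' e → p + q = r → (obj m c a p →ₗ[k] obj n b a' q →ₗ[k] obj l e a r)
  act_comp : ∀ {m n l : ℕ} {c : Fin m → C} {b : Fin n → C} {e e' : Fin l → C} {a a' : C}
    {p q r : ℤ} (σ : Equiv.Perm (Fin l)) (h : ∀ t, e' t = e (σ t)) (g : Graft c b a' e)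
    (g' : Graft c b a' e') (_ : Graft.RenumberResult σ g g') (hr : p + q = r)
    (x : obj m c a p) (y : obj n b a' q), act σ h (comp g hr x y) = comp g' hr x y
  comp_act_left : ∀ {m n l : ℕ} {c c' : Fin m → C} {b : Fin n → C} {e : Fin l → C} {a a' : C}
    {p q r : ℤ} (σ : Equiv.Perm (Fin m)) (h : ∀ t, c' t = c (σ t)) (g : Graft c' b a' e)
    (g' : Graft c b a' e) (_ : Graft.RenumberOuter σ g g') (hr : p + q = r)
    (x : obj m c a p) (y : obj n b a' q), comp g hr (act σ h x) y = comp g' hr x y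
  comp_act_right : ∀ {m n l : ℕ} {c : Fin m → C} {b b' : Fin n → C} {e : Fin l → C} {a a' : C}
    {p q r : ℤ} (σ : Equiv.Perm (Fin n)) (h : ∀ t, b' t = b (σ t)) (g : Graft c b' a' e)
    (g' : Graft c b a' e) (_ : Graft.RenumberInner σ g g') (hr : p + q = r)
    (x : obj m c a p) (y : obj n b a' q), comp g hr x (act σ h y) = comp g' hr x y
  unit_comp : ∀ {n : ℕ} {b : Fin n → C} {a : C} {q : ℤ} (g : Graft (fun _ : Fin 1 => a) b a b)
    (_ : ∀ t, g.inner t = t) (hr : 0 + q = q) (y : obj n b a q), comp g hr (unit a) y = y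
  comp_unit : ∀ {m : ℕ} {c : Fin m → C} {a a' : C} {p : ℤ}
    (g : Graft c (fun _ : Fin 1 => a') a' c) (_ : ∀ j hj, g.outer j hj = j)
    (_ : g.inner 0 = g.slot) (hr : p + 0 = p) (x : obj m c a p), comp g hr x (unit a') = x
  comp_assoc : ∀ {m n o l l₁ l₃ : ℕ} {c : Fin m → C} {b : Fin n → C} {f : Fin o → C}
    {e : Fin l → C} {e₁ : Fin l₁ → C} {e₃ : Fin l₃ → C} {a a₁ a₂ : C} {p q s r r₁ r₃ : ℤ}
    (g₁ : Graft c b a₁ e₁) (g₂ : Graft e₁ f a₂ e) (g₃ : Graft b f a₂ e₃) (g₄ : Graft c e₃ a₁ e)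
    (_ : Graft.Sequential g₁ g₂ g₃ g₄) (h₁ : p + q = r₁) (h₂ : r₁ + s = r) (h₃ : q + s = r₃)
    (h₄ : p + r₃ = r) (x : obj m c a p) (y : obj n b a₁ q) (z : obj o f a₂ s),
    comp g₂ h₂ (comp g₁ h₁ x y) z = comp g₄ h₄ x (comp g₃ h₃ y z)
  comp_comm : ∀ {m n o l l₁ l₃ : ℕ} {c : Fin m → C} {b : Fin n → C} {f : Fin o → C}
    {e : Fin l → C} {e₁ : Fin l₁ → C} {e₃ : Fin l₃ → C} {a a₁ a₂ : C} {p q s r r₁ r₃ : ℤ}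
    (g₁ : Graft c b a₁ e₁) (g₂ : Graft e₁ f a₂ e) (g₃ : Graft c f a₂ e₃) (g₄ : Graft e₃ b a₁ e)
    (_ : Graft.Parallel g₁ g₂ g₃ g₄) (h₁ : p + q = r₁) (h₂ : r₁ + s = r) (h₃ : p + s = r₃)
    (h₄ : r₃ + q = r) (x : obj m c a p) (y : obj n b a₁ q) (z : obj o f a₂ s),
    comp g₂ h₂ (comp g₁ h₁ x y) z = ((-1 : k) ^ (q * s)) • comp g₄ h₄ (comp g₃ h₃ x z) y

/-- A `C`-colored dg-operad: an operad in chain complexes, with differential of degree `-1`. -/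
structure DGOperad (k : Type u) [Field k] (C : Type w) extends GrOperad k C where
  d : ∀ {n : ℕ} {c : Fin n → C} {a : C} (p q : ℤ), q + 1 = p → (obj n c a p →ₗ[k] obj n c a q)
  d_d : ∀ {n : ℕ} {c : Fin n → C} {a : C} (p q r : ℤ) (h : q + 1 = p) (h' : r + 1 = q)
    (x : obj n c a p), d q r h' (d p q h x) = 0
  d_act : ∀ {n : ℕ} {c c' : Fin n → C} {a : C} (p q : ℤ) (h : q + 1 = p)
    (σ : Equiv.Perm (Fin n)) (hσ : ∀ i, c' i = c (σ i)) (x : obj n c a p),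
    d p q h (act σ hσ x) = act σ hσ (d p q h x)
  d_comp : ∀ {m n l : ℕ} {c : Fin m → C} {b : Fin n → C} {e : Fin l → C} {a a' : C}
    {p p' q q' r r' : ℤ} (g : Graft c b a' e) (hr : p + q = r) (hp' : p' + 1 = p)
    (hq' : q' + 1 = q) (hr' : r' + 1 = r) (h₁ : p' + q = r') (h₂ : p + q' = r')
    (x : obj m c a p) (y : obj n b a' q),
    d r r' hr' (comp g hr x y) =
      comp g h₁ (d p p' hp' x) y + ((-1 : k) ^ p) • comp g h₂ x (d q q' hq' y)

/-! ### Morphisms (identical on colors) -/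

section Hom

variable {k : Type u} [Field k] {C : Type w}

/-- Morphisms of colored collections: equivariant linear maps of degree `0`. -/
@[ext] structure GrCollection.Hom (E F : GrCollection k C) where
  app : ∀ {n : ℕ} {c : Fin n → C} {a : C} {p : ℤ}, E.obj n c a p →ₗ[k] F.obj n c a p
  app_act : ∀ {n : ℕ} {c c' : Fin n → C} {a : C} {p : ℤ} (σ : Equiv.Perm (Fin n))
    (h : ∀ i, c' i = c (σ i)) (x : E.obj n c a p), app (E.act σ h x) = F.act σ h (app x)

/-- Morphisms of colored operads. -/
@[ext] structure GrOperad.Hom (P Q : GrOperad k C) extends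
    toCollectionHom : GrCollection.Hom P.toGrCollection Q.toGrCollection where
  app_unit : ∀ a : C, app (P.unit a) = Q.unit a
  app_comp : ∀ {m n l : ℕ} {c : Fin m → C} {b : Fin n → C} {e : Fin l → C} {a a' : C} {p q r : ℤ}
    (g : Graft c b a' e) (hr : p + q = r) (x : P.obj m c a p) (y : P.obj n b a' q),
    app (P.comp g hr x y) = Q.comp g hr (app x) (app y)

/-- Morphisms of colored dg-operads. -/
@[ext] structure DGOperad.Hom (P Q : DGOperad k C) extends
    toOperadHom : GrOperad.Hom P.toGrOperad Q.toGrOperad where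
  app_d : ∀ {n : ℕ} {c : Fin n → C} {a : C} (p q : ℤ) (h : q + 1 = p) (x : P.obj n c a p),
    app (P.d p q h x) = Q.d p q h (app x)

/-- The identity of an operad. -/
def GrOperad.Hom.id (P : GrOperad k C) : GrOperad.Hom P P where
  app := LinearMap.id
  app_act _ _ _ := rfl
  app_unit _ := rfl
  app_comp _ _ _ _ := rfl

/-- The composite `g ∘ f`. -/
def GrOperad.Hom.comp {P Q R : GrOperad k C} (g : GrOperad.Hom Q R) (f : GrOperad.Hom P Q) :
    GrOperad.Hom P R where
  app := g.app ∘ₗ f.app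
  app_act σ h x := by simp [f.app_act, g.app_act]
  app_unit a := by simp [f.app_unit, g.app_unit]
  app_comp _ hr x y := by simp [f.app_comp, g.app_comp]

/-- The identity of a dg-operad. -/
def DGOperad.Hom.id (P : DGOperad k C) : DGOperad.Hom P P where
  toOperadHom := GrOperad.Hom.id P.toGrOperad
  app_d _ _ _ _ := rfl

/-- The composite `g ∘ f`. -/
def DGOperad.Hom.comp {P Q R : DGOperad k C} (g : DGOperad.Hom Q R) (f : DGOperad.Hom P Q) :
    DGOperad.Hom P R where
  toOperadHom := g.toOperadHom.comp f.toOperadHom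
  app_d p q h x := by
    change g.app (f.app (P.d p q h x)) = R.d p q h (g.app (f.app x))
    rw [f.app_d, g.app_d]

/-- A graded operad as a dg-operad with trivial differential. -/
def GrOperad.toDG (P : GrOperad k C) : DGOperad k C where
  toGrOperad := P
  d _ _ _ := 0
  d_d := by simp
  d_act := by simp
  d_comp := by simp

/-- A morphism of graded operads as a morphism of dg-operads with trivial differentials. -/
def GrOperad.Hom.toDG {P Q : GrOperad k C} (f : GrOperad.Hom P Q) : DGOperad.Hom P.toDG Q.toDG where
  toOperadHom := f
  app_d _ _ _ _ := map_zero f.app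

/-! ### Homology isomorphisms -/

/-- The cycles of degree `p`. -/
def DGOperad.cycles (P : DGOperad k C) (n : ℕ) (c : Fin n → C) (a : C) (p : ℤ) :
    Submodule k (P.obj n c a p) :=
  LinearMap.ker (P.d (c := c) (a := a) p (p - 1) (sub_add_cancel p 1))

/-- The boundaries of degree `p`. -/
def DGOperad.boundaries (P : DGOperad k C) (n : ℕ) (c : Fin n → C) (a : C) (p : ℤ) :
    Submodule k (P.obj n c a p) :=
  LinearMap.range (P.d (c := c) (a := a) (p + 1) p rfl)

/-- The homology of degree `p`: cycles modulo boundaries. -/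
abbrev DGOperad.homology (P : DGOperad k C) (n : ℕ) (c : Fin n → C) (a : C) (p : ℤ) : Type u :=
  P.cycles n c a p ⧸ (P.boundaries n c a p).submoduleOf (P.cycles n c a p)

/-- The map on cycles. -/
def DGOperad.Hom.cyclesMap {P Q : DGOperad k C} (f : DGOperad.Hom P Q) (n : ℕ) (c : Fin n → C)
    (a : C) (p : ℤ) : P.cycles n c a p →ₗ[k] Q.cycles n c a p :=
  f.app.restrict (fun x hx => by
    have hx' : P.d p (p - 1) (sub_add_cancel p 1) x = 0 := hx
    change Q.d p (p - 1) (sub_add_cancel p 1) (f.app x) = 0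
    rw [← f.app_d, hx', map_zero])

/-- The map on homology. -/
def DGOperad.Hom.homologyMap {P Q : DGOperad k C} (f : DGOperad.Hom P Q) (n : ℕ) (c : Fin n → C)
    (a : C) (p : ℤ) : P.homology n c a p →ₗ[k] Q.homology n c a p :=
  Submodule.mapQ _ _ (f.cyclesMap n c a p) (by
    rintro x ⟨y, hy⟩
    refine ⟨f.app y, ?_⟩
    rw [← f.app_d, hy]
    rfl)

/-- Homology isomorphisms of colored dg-operads. -/
def DGOperad.Hom.IsHomologyIso {P Q : DGOperad k C} (f : DGOperad.Hom P Q) : Prop :=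
  ∀ (n : ℕ) (c : Fin n → C) (a : C) (p : ℤ), Function.Bijective (f.homologyMap n c a p)

/-! ### Elemental cofibrations -/

/-- The suboperad generated by a family of subsets. -/
inductive GrOperad.Generated (P : GrOperad k C)
    (T : ∀ (n : ℕ) (c : Fin n → C) (a : C) (p : ℤ), Set (P.obj n c a p)) :
    ∀ {n : ℕ} {c : Fin n → C} {a : C} {p : ℤ}, P.obj n c a p → Prop
  | of {n : ℕ} {c : Fin n → C} {a : C} {p : ℤ} (x : P.obj n c a p) :
      x ∈ T n c a p → Generated P T x
  | unit (a : C) : Generated P T (P.unit a)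
  | zero {n : ℕ} {c : Fin n → C} {a : C} {p : ℤ} : Generated P T (0 : P.obj n c a p)
  | add {n : ℕ} {c : Fin n → C} {a : C} {p : ℤ} (x y : P.obj n c a p) :
      Generated P T x → Generated P T y → Generated P T (x + y)
  | smul {n : ℕ} {c : Fin n → C} {a : C} {p : ℤ} (r : k) (x : P.obj n c a p) :
      Generated P T x → Generated P T (r • x)
  | act {n : ℕ} {c c' : Fin n → C} {a : C} {p : ℤ} (σ : Equiv.Perm (Fin n))
      (h : ∀ i, c' i = c (σ i)) (x : P.obj n c a p) : Generated P T x → Generated P T (P.act σ h x)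
  | comp {m n l : ℕ} {c : Fin m → C} {b : Fin n → C} {e : Fin l → C} {a a' : C} {p q r : ℤ}
      (g : Graft c b a' e) (hr : p + q = r) (x : P.obj m c a p) (y : P.obj n b a' q) :
      Generated P T x → Generated P T y → Generated P T (P.comp g hr x y)

/-- `ι : S → Q` is an elemental cofibration: as a graded operad, `Q` is the free product (coproduct)
`S * Γ(E)` of `S` with the free operad on a collection `E = ⨁ Eₙ`, with `ι` the inclusion of `S`,
and the differential maps `Eₙ` into the suboperad generated by `S` and all the `Eₘ`, `m < n`. -/
def DGOperad.Hom.IsElementalCofibration {S Q : DGOperad k C} (ι : DGOperad.Hom S Q) : Prop :=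
  ∃ (E : ℕ → GrCollection k C) (j : ∀ i, GrCollection.Hom (E i) Q.toGrCollection),
    (∀ (X : GrOperad k C) (f : GrOperad.Hom S.toGrOperad X)
      (g : ∀ i, GrCollection.Hom (E i) X.toGrCollection),
      ∃! h : GrOperad.Hom Q.toGrOperad X, h.comp ι.toOperadHom = f ∧
        ∀ (i n : ℕ) (c : Fin n → C) (a : C) (p : ℤ) (x : (E i).obj n c a p),
          h.app ((j i).app x) = (g i).app x) ∧
    ∀ (i n : ℕ) (c : Fin n → C) (a : C) (p q : ℤ) (h : q + 1 = p) (x : (E i).obj n c a p),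
      Q.toGrOperad.Generated
        (fun n c a p => {y | (∃ s : S.obj n c a p, ι.app s = y) ∨
          ∃ i' < i, ∃ z : (E i').obj n c a p, (j i').app z = y})
        (Q.d p q h ((j i).app x))

/-- `Q` is elementally cofibrant: as a graded operad, it is the free operad `Γ(E)` on a collection
`E = ⨁ Eₙ`, and the differential maps `Eₙ` into the suboperad generated by all the `Eₘ`,
`m < n`. -/
def DGOperad.IsElementallyCofibrant (Q : DGOperad k C) : Prop :=
  ∃ (E : ℕ → GrCollection k C) (j : ∀ i, GrCollection.Hom (E i) Q.toGrCollection),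
    (∀ (X : GrOperad k C) (g : ∀ i, GrCollection.Hom (E i) X.toGrCollection),
      ∃! h : GrOperad.Hom Q.toGrOperad X,
        ∀ (i n : ℕ) (c : Fin n → C) (a : C) (p : ℤ) (x : (E i).obj n c a p),
          h.app ((j i).app x) = (g i).app x) ∧
    ∀ (i n : ℕ) (c : Fin n → C) (a : C) (p q : ℤ) (h : q + 1 = p) (x : (E i).obj n c a p),
      Q.toGrOperad.Generated
        (fun n c a p => {y | ∃ i' < i, ∃ z : (E i').obj n c a p, (j i').app z = y})
        (Q.d p q h ((j i).app x))

end Hom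

/-! ### Operads given by generators and relations -/

section Presented

variable (k : Type u) [Field k] {C : Type u}

/-- Formal expressions in the generators `G`, built with the operations of a graded operad. -/
inductive Raw (G : (n : ℕ) → (Fin n → C) → C → ℤ → Type u) :
    (n : ℕ) → (Fin n → C) → C → ℤ → Type u
  | gen {n : ℕ} {c : Fin n → C} {a : C} {p : ℤ} (x : G n c a p) : Raw G n c a p
  | unit (a : C) : Raw G 1 (fun _ => a) a 0
  | zero {n : ℕ} {c : Fin n → C} {a : C} {p : ℤ} : Raw G n c a p
  | add {n : ℕ} {c : Fin n → C} {a : C} {p : ℤ} (x y : Raw G n c a p) : Raw G n c a p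
  | smul {n : ℕ} {c : Fin n → C} {a : C} {p : ℤ} (r : k) (x : Raw G n c a p) : Raw G n c a p
  | act {n : ℕ} {c c' : Fin n → C} {a : C} {p : ℤ} (σ : Equiv.Perm (Fin n))
      (h : ∀ i, c' i = c (σ i)) (x : Raw G n c a p) : Raw G n c' a p
  | comp {m n l : ℕ} {c : Fin m → C} {b : Fin n → C} {e : Fin l → C} {a a' : C} {p q r : ℤ}
      (g : Graft c b a' e) (hr : p + q = r) (x : Raw G m c a p) (y : Raw G n b a' q) :
      Raw G l e a r

variable {k} {G : (n : ℕ) → (Fin n → C) → C → ℤ → Type u}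

/-- The congruence generated by the relations `R` and the axioms of a graded operad. -/
inductive Raw.Rel (R : ∀ (n : ℕ) (c : Fin n → C) (a : C) (p : ℤ),
      Raw k G n c a p → Raw k G n c a p → Prop) :
    ∀ {n : ℕ} {c : Fin n → C} {a : C} {p : ℤ}, Raw k G n c a p → Raw k G n c a p → Prop
  | of {n : ℕ} {c : Fin n → C} {a : C} {p : ℤ} {x y : Raw k G n c a p} : R n c a p x y → Rel R x y
  | refl {n : ℕ} {c : Fin n → C} {a : C} {p : ℤ} (x : Raw k G n c a p) : Rel R x x
  | symm {n : ℕ} {c : Fin n → C} {a : C} {p : ℤ} {x y : Raw k G n c a p} : Rel R x y → Rel R y x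
  | trans {n : ℕ} {c : Fin n → C} {a : C} {p : ℤ} {x y z : Raw k G n c a p} :
      Rel R x y → Rel R y z → Rel R x z
  | add_congr {n : ℕ} {c : Fin n → C} {a : C} {p : ℤ} {x x' y y' : Raw k G n c a p} :
      Rel R x x' → Rel R y y' → Rel R (x.add y) (x'.add y')
  | smul_congr {n : ℕ} {c : Fin n → C} {a : C} {p : ℤ} (r : k) {x x' : Raw k G n c a p} :
      Rel R x x' → Rel R (x.smul r) (x'.smul r)
  | act_congr {n : ℕ} {c c' : Fin n → C} {a : C} {p : ℤ} (σ : Equiv.Perm (Fin n))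
      (h : ∀ i, c' i = c (σ i)) {x x' : Raw k G n c a p} :
      Rel R x x' → Rel R (x.act σ h) (x'.act σ h)
  | comp_congr {m n l : ℕ} {c : Fin m → C} {b : Fin n → C} {e : Fin l → C} {a a' : C} {p q r : ℤ}
      (g : Graft c b a' e) (hr : p + q = r) {x x' : Raw k G m c a p} {y y' : Raw k G n b a' q} :
      Rel R x x' → Rel R y y' → Rel R (x.comp g hr y) (x'.comp g hr y')
  | add_assoc {n : ℕ} {c : Fin n → C} {a : C} {p : ℤ} (x y z : Raw k G n c a p) :
      Rel R ((x.add y).add z) (x.add (y.add z))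
  | add_comm {n : ℕ} {c : Fin n → C} {a : C} {p : ℤ} (x y : Raw k G n c a p) :
      Rel R (x.add y) (y.add x)
  | zero_add {n : ℕ} {c : Fin n → C} {a : C} {p : ℤ} (x : Raw k G n c a p) :
      Rel R (Raw.zero.add x) x
  | smul_zero {n : ℕ} {c : Fin n → C} {a : C} {p : ℤ} (r : k) :
      Rel R ((Raw.zero : Raw k G n c a p).smul r) Raw.zero
  | zero_smul {n : ℕ} {c : Fin n → C} {a : C} {p : ℤ} (x : Raw k G n c a p) :
      Rel R (x.smul 0) Raw.zero
  | one_smul {n : ℕ} {c : Fin n → C} {a : C} {p : ℤ} (x : Raw k G n c a p) : Rel R (x.smul 1) x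
  | mul_smul {n : ℕ} {c : Fin n → C} {a : C} {p : ℤ} (r s : k) (x : Raw k G n c a p) :
      Rel R (x.smul (r * s)) ((x.smul s).smul r)
  | smul_add {n : ℕ} {c : Fin n → C} {a : C} {p : ℤ} (r : k) (x y : Raw k G n c a p) :
      Rel R ((x.add y).smul r) ((x.smul r).add (y.smul r))
  | add_smul {n : ℕ} {c : Fin n → C} {a : C} {p : ℤ} (r s : k) (x : Raw k G n c a p) :
      Rel R (x.smul (r + s)) ((x.smul r).add (x.smul s))
  | act_add {n : ℕ} {c c' : Fin n → C} {a : C} {p : ℤ} (σ : Equiv.Perm (Fin n))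
      (h : ∀ i, c' i = c (σ i)) (x y : Raw k G n c a p) :
      Rel R ((x.add y).act σ h) ((x.act σ h).add (y.act σ h))
  | act_smul {n : ℕ} {c c' : Fin n → C} {a : C} {p : ℤ} (σ : Equiv.Perm (Fin n))
      (h : ∀ i, c' i = c (σ i)) (r : k) (x : Raw k G n c a p) :
      Rel R ((x.smul r).act σ h) ((x.act σ h).smul r)
  | add_comp {m n l : ℕ} {c : Fin m → C} {b : Fin n → C} {e : Fin l → C} {a a' : C} {p q r : ℤ}
      (g : Graft c b a' e) (hr : p + q = r) (x x' : Raw k G m c a p) (y : Raw k G n b a' q) :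
      Rel R ((x.add x').comp g hr y) ((x.comp g hr y).add (x'.comp g hr y))
  | smul_comp {m n l : ℕ} {c : Fin m → C} {b : Fin n → C} {e : Fin l → C} {a a' : C} {p q r : ℤ}
      (g : Graft c b a' e) (hr : p + q = r) (s : k) (x : Raw k G m c a p) (y : Raw k G n b a' q) :
      Rel R ((x.smul s).comp g hr y) ((x.comp g hr y).smul s)
  | comp_add {m n l : ℕ} {c : Fin m → C} {b : Fin n → C} {e : Fin l → C} {a a' : C} {p q r : ℤ}
      (g : Graft c b a' e) (hr : p + q = r) (x : Raw k G m c a p) (y y' : Raw k G n b a' q) :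
      Rel R (x.comp g hr (y.add y')) ((x.comp g hr y).add (x.comp g hr y'))
  | comp_smul {m n l : ℕ} {c : Fin m → C} {b : Fin n → C} {e : Fin l → C} {a a' : C} {p q r : ℤ}
      (g : Graft c b a' e) (hr : p + q = r) (s : k) (x : Raw k G m c a p) (y : Raw k G n b a' q) :
      Rel R (x.comp g hr (y.smul s)) ((x.comp g hr y).smul s)
  | act_one {n : ℕ} {c : Fin n → C} {a : C} {p : ℤ} (h : ∀ i, c i = c ((1 : Equiv.Perm (Fin n)) i))
      (x : Raw k G n c a p) : Rel R (x.act 1 h) x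
  | act_mul {n : ℕ} {c c' c'' : Fin n → C} {a : C} {p : ℤ} (σ τ : Equiv.Perm (Fin n))
      (h : ∀ i, c' i = c (σ i)) (h' : ∀ i, c'' i = c' (τ i)) (h'' : ∀ i, c'' i = c ((σ * τ) i))
      (x : Raw k G n c a p) : Rel R ((x.act σ h).act τ h') (x.act (σ * τ) h'')
  | act_comp {m n l : ℕ} {c : Fin m → C} {b : Fin n → C} {e e' : Fin l → C} {a a' : C}
      {p q r : ℤ} (σ : Equiv.Perm (Fin l)) (h : ∀ t, e' t = e (σ t)) (g : Graft c b a' e)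
      (g' : Graft c b a' e') (_ : Graft.RenumberResult σ g g') (hr : p + q = r)
      (x : Raw k G m c a p) (y : Raw k G n b a' q) :
      Rel R ((x.comp g hr y).act σ h) (x.comp g' hr y)
  | comp_act_left {m n l : ℕ} {c c' : Fin m → C} {b : Fin n → C} {e : Fin l → C} {a a' : C}
      {p q r : ℤ} (σ : Equiv.Perm (Fin m)) (h : ∀ t, c' t = c (σ t)) (g : Graft c' b a' e)
      (g' : Graft c b a' e) (_ : Graft.RenumberOuter σ g g') (hr : p + q = r)
      (x : Raw k G m c a p) (y : Raw k G n b a' q) :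
      Rel R ((x.act σ h).comp g hr y) (x.comp g' hr y)
  | comp_act_right {m n l : ℕ} {c : Fin m → C} {b b' : Fin n → C} {e : Fin l → C} {a a' : C}
      {p q r : ℤ} (σ : Equiv.Perm (Fin n)) (h : ∀ t, b' t = b (σ t)) (g : Graft c b' a' e)
      (g' : Graft c b a' e) (_ : Graft.RenumberInner σ g g') (hr : p + q = r)
      (x : Raw k G m c a p) (y : Raw k G n b a' q) :
      Rel R (x.comp g hr (y.act σ h)) (x.comp g' hr y)
  | unit_comp {n : ℕ} {b : Fin n → C} {a : C} {q : ℤ} (g : Graft (fun _ : Fin 1 => a) b a b)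
      (_ : ∀ t, g.inner t = t) (hr : 0 + q = q) (y : Raw k G n b a q) :
      Rel R ((Raw.unit a).comp g hr y) y
  | comp_unit {m : ℕ} {c : Fin m → C} {a a' : C} {p : ℤ}
      (g : Graft c (fun _ : Fin 1 => a') a' c) (_ : ∀ j hj, g.outer j hj = j)
      (_ : g.inner 0 = g.slot) (hr : p + 0 = p) (x : Raw k G m c a p) :
      Rel R (x.comp g hr (Raw.unit a')) x
  | comp_assoc {m n o l l₁ l₃ : ℕ} {c : Fin m → C} {b : Fin n → C} {f : Fin o → C}
      {e : Fin l → C} {e₁ : Fin l₁ → C} {e₃ : Fin l₃ → C} {a a₁ a₂ : C} {p q s r r₁ r₃ : ℤ}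
      (g₁ : Graft c b a₁ e₁) (g₂ : Graft e₁ f a₂ e) (g₃ : Graft b f a₂ e₃) (g₄ : Graft c e₃ a₁ e)
      (_ : Graft.Sequential g₁ g₂ g₃ g₄) (h₁ : p + q = r₁) (h₂ : r₁ + s = r) (h₃ : q + s = r₃)
      (h₄ : p + r₃ = r) (x : Raw k G m c a p) (y : Raw k G n b a₁ q) (z : Raw k G o f a₂ s) :
      Rel R ((x.comp g₁ h₁ y).comp g₂ h₂ z) (x.comp g₄ h₄ (y.comp g₃ h₃ z))
  | comp_comm {m n o l l₁ l₃ : ℕ} {c : Fin m → C} {b : Fin n → C} {f : Fin o → C}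
      {e : Fin l → C} {e₁ : Fin l₁ → C} {e₃ : Fin l₃ → C} {a a₁ a₂ : C} {p q s r r₁ r₃ : ℤ}
      (g₁ : Graft c b a₁ e₁) (g₂ : Graft e₁ f a₂ e) (g₃ : Graft c f a₂ e₃) (g₄ : Graft e₃ b a₁ e)
      (_ : Graft.Parallel g₁ g₂ g₃ g₄) (h₁ : p + q = r₁) (h₂ : r₁ + s = r) (h₃ : p + s = r₃)
      (h₄ : r₃ + q = r) (x : Raw k G m c a p) (y : Raw k G n b a₁ q) (z : Raw k G o f a₂ s) :
      Rel R ((x.comp g₁ h₁ y).comp g₂ h₂ z) (((x.comp g₃ h₃ z).comp g₄ h₄ y).smul ((-1) ^ (q * s)))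

variable (R : ∀ (n : ℕ) (c : Fin n → C) (a : C) (p : ℤ),
  Raw k G n c a p → Raw k G n c a p → Prop)

/-- The setoid of the congruence. -/
def Raw.setoid (n : ℕ) (c : Fin n → C) (a : C) (p : ℤ) : Setoid (Raw k G n c a p) where
  r := Raw.Rel R
  iseqv := ⟨.refl, .symm, .trans⟩

/-- Formal expressions modulo the congruence. -/
def PresentedObj (n : ℕ) (c : Fin n → C) (a : C) (p : ℤ) : Type u :=
  Quotient (Raw.setoid R n c a p)

variable {R}

/-- The class of a formal expression. -/
def PresentedObj.mk {n : ℕ} {c : Fin n → C} {a : C} {p : ℤ} (x : Raw k G n c a p) :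
    PresentedObj R n c a p :=
  Quotient.mk (Raw.setoid R n c a p) x

theorem PresentedObj.ind {n : ℕ} {c : Fin n → C} {a : C} {p : ℤ}
    {motive : PresentedObj R n c a p → Prop} (h : ∀ x, motive (PresentedObj.mk x))
    (x : PresentedObj R n c a p) : motive x :=
  Quotient.ind h x

theorem PresentedObj.sound {n : ℕ} {c : Fin n → C} {a : C} {p : ℤ} {x y : Raw k G n c a p}
    (h : Raw.Rel R x y) : (PresentedObj.mk x : PresentedObj R n c a p) = PresentedObj.mk y :=
  Quotient.sound h

instance (n : ℕ) (c : Fin n → C) (a : C) (p : ℤ) : Zero (PresentedObj R n c a p) where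
  zero := PresentedObj.mk Raw.zero

instance (n : ℕ) (c : Fin n → C) (a : C) (p : ℤ) : Add (PresentedObj R n c a p) where
  add := Quotient.map₂ Raw.add (fun _ _ h _ _ h' => .add_congr h h')

instance (n : ℕ) (c : Fin n → C) (a : C) (p : ℤ) : AddCommMonoid (PresentedObj R n c a p) where
  add_assoc x y z := by
    induction x using PresentedObj.ind; induction y using PresentedObj.ind
    induction z using PresentedObj.ind
    exact PresentedObj.sound (.add_assoc _ _ _)
  add_comm x y := by
    induction x using PresentedObj.ind; induction y using PresentedObj.ind
    exact PresentedObj.sound (.add_comm _ _)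
  zero_add x := by
    induction x using PresentedObj.ind
    exact PresentedObj.sound (.zero_add _)
  add_zero x := by
    induction x using PresentedObj.ind
    exact PresentedObj.sound (.trans (.add_comm _ _) (.zero_add _))
  nsmul := nsmulRec

instance (n : ℕ) (c : Fin n → C) (a : C) (p : ℤ) : Module k (PresentedObj R n c a p) where
  smul r := Quotient.map (Raw.smul r) (fun _ _ h => .smul_congr r h)
  one_smul x := by
    induction x using PresentedObj.ind
    exact PresentedObj.sound (.one_smul _)
  mul_smul r s x := by
    induction x using PresentedObj.ind
    exact PresentedObj.sound (.mul_smul _ _ _)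
  smul_zero r := PresentedObj.sound (.smul_zero _)
  zero_smul x := by
    induction x using PresentedObj.ind
    exact PresentedObj.sound (.zero_smul _)
  smul_add r x y := by
    induction x using PresentedObj.ind; induction y using PresentedObj.ind
    exact PresentedObj.sound (.smul_add _ _ _)
  add_smul r s x := by
    induction x using PresentedObj.ind
    exact PresentedObj.sound (.add_smul _ _ _)

instance (n : ℕ) (c : Fin n → C) (a : C) (p : ℤ) : AddCommGroup (PresentedObj R n c a p) :=
  Module.addCommMonoidToAddCommGroup k

variable (R)

/-- The operad with generators `G` and relations `R`: the free graded operad on `G` modulo the ideal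
generated by `R`. -/
def presentedOperad : GrOperad k C where
  obj := PresentedObj R
  act σ h :=
    { toFun := Quotient.map (Raw.act σ h) (fun _ _ h' => .act_congr σ h h')
      map_add' := fun x y => by
        induction x using PresentedObj.ind; induction y using PresentedObj.ind
        exact PresentedObj.sound (.act_add _ _ _ _)
      map_smul' := fun r x => by
        induction x using PresentedObj.ind
        exact PresentedObj.sound (.act_smul _ _ _ _) }
  act_one h x := by
    induction x using PresentedObj.ind
    exact PresentedObj.sound (.act_one _ _)
  act_mul σ τ h h' h'' x := by
    induction x using PresentedObj.ind
    exact PresentedObj.sound (.act_mul _ _ _ _ _ _)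
  unit a := PresentedObj.mk (Raw.unit a)
  comp g hr := LinearMap.mk₂ k
    (Quotient.map₂ (Raw.comp g hr) (fun _ _ h _ _ h' => .comp_congr g hr h h'))
    (fun x x' y => by
      induction x using PresentedObj.ind; induction x' using PresentedObj.ind
      induction y using PresentedObj.ind
      exact PresentedObj.sound (.add_comp _ _ _ _ _))
    (fun r x y => by
      induction x using PresentedObj.ind; induction y using PresentedObj.ind
      exact PresentedObj.sound (.smul_comp _ _ _ _ _))
    (fun x y y' => by
      induction x using PresentedObj.ind; induction y' using PresentedObj.ind
      induction y using PresentedObj.ind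
      exact PresentedObj.sound (.comp_add _ _ _ _ _))
    (fun r x y => by
      induction x using PresentedObj.ind; induction y using PresentedObj.ind
      exact PresentedObj.sound (.comp_smul _ _ _ _ _))
  act_comp σ h g g' hg hr x y := by
    induction x using PresentedObj.ind; induction y using PresentedObj.ind
    exact PresentedObj.sound (.act_comp _ _ _ _ hg _ _ _)
  comp_act_left σ h g g' hg hr x y := by
    induction x using PresentedObj.ind; induction y using PresentedObj.ind
    exact PresentedObj.sound (.comp_act_left _ _ _ _ hg _ _ _)
  comp_act_right σ h g g' hg hr x y := by
    induction x using PresentedObj.ind; induction y using PresentedObj.ind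
    exact PresentedObj.sound (.comp_act_right _ _ _ _ hg _ _ _)
  unit_comp g hg hr y := by
    induction y using PresentedObj.ind
    exact PresentedObj.sound (.unit_comp _ hg _ _)
  comp_unit g hg hg' hr y := by
    induction y using PresentedObj.ind
    exact PresentedObj.sound (.comp_unit _ hg hg' _ _)
  comp_assoc g₁ g₂ g₃ g₄ hg h₁ h₂ h₃ h₄ x y z := by
    induction x using PresentedObj.ind; induction y using PresentedObj.ind
    induction z using PresentedObj.ind
    exact PresentedObj.sound (.comp_assoc _ _ _ _ hg _ _ _ _ _ _ _)
  comp_comm g₁ g₂ g₃ g₄ hg h₁ h₂ h₃ h₄ x y z := by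
    induction x using PresentedObj.ind; induction y using PresentedObj.ind
    induction z using PresentedObj.ind
    exact PresentedObj.sound (.comp_comm _ _ _ _ hg _ _ _ _ _ _ _)

/-- The value of a formal expression in an operad, given values of the generators. -/
def Raw.eval (X : GrOperad k C)
    (γ : ∀ (n : ℕ) (c : Fin n → C) (a : C) (p : ℤ), G n c a p → X.obj n c a p) :
    ∀ {n : ℕ} {c : Fin n → C} {a : C} {p : ℤ}, Raw k G n c a p → X.obj n c a p
  | _, _, _, _, .gen x => γ _ _ _ _ x
  | _, _, _, _, .unit a => X.unit a
  | _, _, _, _, .zero => 0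
  | _, _, _, _, .add x y => x.eval X γ + y.eval X γ
  | _, _, _, _, .smul r x => r • x.eval X γ
  | _, _, _, _, .act σ h x => X.act σ h (x.eval X γ)
  | _, _, _, _, .comp g hr x y => X.comp g hr (x.eval X γ) (y.eval X γ)

theorem Raw.eval_eq (X : GrOperad k C)
    (γ : ∀ (n : ℕ) (c : Fin n → C) (a : C) (p : ℤ), G n c a p → X.obj n c a p)
    (hγ : ∀ n c a p (x y : Raw k G n c a p), R n c a p x y → x.eval X γ = y.eval X γ)
    {n : ℕ} {c : Fin n → C} {a : C} {p : ℤ} {x y : Raw k G n c a p} (h : Raw.Rel R x y) :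
    x.eval X γ = y.eval X γ := by
  induction h with
  | of h => exact hγ _ _ _ _ _ _ h
  | refl => rfl
  | symm _ ih => exact ih.symm
  | trans _ _ ih ih' => exact ih.trans ih'
  | add_congr _ _ ih ih' => simp only [Raw.eval, ih, ih']
  | smul_congr _ _ ih => simp only [Raw.eval, ih]
  | act_congr _ _ _ ih => simp only [Raw.eval, ih]
  | comp_congr _ _ _ _ ih ih' => simp only [Raw.eval, ih, ih']
  | add_assoc => simp only [Raw.eval, _root_.add_assoc]
  | add_comm => simp only [Raw.eval, _root_.add_comm]
  | zero_add => simp only [Raw.eval, _root_.zero_add]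
  | smul_zero => simp only [Raw.eval, _root_.smul_zero]
  | zero_smul => simp only [Raw.eval, _root_.zero_smul]
  | one_smul => simp only [Raw.eval, _root_.one_smul]
  | mul_smul => simp only [Raw.eval, SemigroupAction.mul_smul]
  | smul_add => simp only [Raw.eval, _root_.smul_add]
  | add_smul => simp only [Raw.eval, _root_.add_smul]
  | act_add => simp only [Raw.eval, map_add]
  | act_smul => simp only [Raw.eval, map_smul]
  | add_comp => simp only [Raw.eval, map_add, LinearMap.add_apply]
  | smul_comp => simp only [Raw.eval, map_smul, LinearMap.smul_apply]
  | comp_add => simp only [Raw.eval, map_add]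
  | comp_smul => simp only [Raw.eval, map_smul]
  | act_one => exact X.act_one _ _
  | act_mul => exact X.act_mul _ _ _ _ _ _
  | act_comp _ _ _ _ hg => exact X.act_comp _ _ _ _ hg _ _ _
  | comp_act_left _ _ _ _ hg => exact X.comp_act_left _ _ _ _ hg _ _ _
  | comp_act_right _ _ _ _ hg => exact X.comp_act_right _ _ _ _ hg _ _ _
  | unit_comp _ hg => exact X.unit_comp _ hg _ _
  | comp_unit _ hg hg' => exact X.comp_unit _ hg hg' _ _
  | comp_assoc _ _ _ _ hg => exact X.comp_assoc _ _ _ _ hg _ _ _ _ _ _ _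
  | comp_comm _ _ _ _ hg => exact X.comp_comm _ _ _ _ hg _ _ _ _ _ _ _

/-- The morphism from a presented operad given by values of the generators that satisfy the
relations. -/
def presentedOperad.lift (X : GrOperad k C)
    (γ : ∀ (n : ℕ) (c : Fin n → C) (a : C) (p : ℤ), G n c a p → X.obj n c a p)
    (hγ : ∀ n c a p (x y : Raw k G n c a p), R n c a p x y → x.eval X γ = y.eval X γ) :
    GrOperad.Hom (presentedOperad R) X where
  app :=
    { toFun := Quotient.lift (fun x => x.eval X γ) (fun _ _ h => Raw.eval_eq R X γ hγ h)
      map_add' := fun x y => by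
        induction x using PresentedObj.ind; induction y using PresentedObj.ind
        rfl
      map_smul' := fun r x => by
        induction x using PresentedObj.ind
        rfl }
  app_act σ h x := by
    induction x using PresentedObj.ind
    rfl
  app_unit a := rfl
  app_comp g hr x y := by
    induction x using PresentedObj.ind; induction y using PresentedObj.ind
    rfl

end Presented

/-! ### Simultaneous precomposition `x (f, …, f)` with a unary operation of degree `0` -/

section FillAll

variable {k : Type u} [Field k] {C : Type u} {G : (n : ℕ) → (Fin n → C) → C → ℤ → Type u}

/-- Numbering of the inputs when the input `i` is replaced by a single input. -/
def replaceNum {n : ℕ} (i : Fin n) : {j : Fin n // j ≠ i} ⊕ Fin 1 ≃ Fin n where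
  toFun := Sum.elim (fun j => j.1) (fun _ => i)
  invFun j := if h : j = i then Sum.inr 0 else Sum.inl ⟨j, h⟩
  left_inv := by
    rintro (⟨j, hj⟩ | t)
    · simp [hj]
    · simp [Subsingleton.elim t 0]
  right_inv j := by
    by_cases h : j = i <;> simp [h]

/-- The first `s` of `n` inputs have color `v`, the others have color `w`. -/
def stageColor {n : ℕ} (v w : C) (s : ℕ) : Fin n → C := fun j => if j.1 < s then v else w

/-- Plug an operation of color `v → w` into the input number `s`. -/
def stageGraft {n : ℕ} (v w : C) (s : ℕ) (h : s < n) :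
    Graft (stageColor (n := n) v w s) (fun _ : Fin 1 => v) w (stageColor (n := n) v w (s + 1)) where
  slot := ⟨s, h⟩
  slot_color := by simp [stageColor]
  num := replaceNum ⟨s, h⟩
  num_color := by
    rintro (⟨j, hj⟩ | t)
    · have hj' : j.1 ≠ s := fun h' => hj (Fin.ext h')
      have : j.1 < s + 1 ↔ j.1 < s := by omega
      simp [replaceNum, stageColor, this]
    · simp [replaceNum, stageColor]

/-- `f` plugged into the first `s` inputs of `x`. -/
def Raw.fill {n : ℕ} {v w a : C} {p : ℤ} (f : Raw k G 1 (fun _ => v) w 0)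
    (x : Raw k G n (fun _ => w) a p) : (s : ℕ) → Raw k G n (stageColor v w s) a p
  | 0 => x.act 1 (by simp [stageColor])
  | s + 1 =>
    if h : s < n then (Raw.fill f x s).comp (stageGraft v w s h) (add_zero p) f
    else (Raw.fill f x s).act 1 (by
      intro i
      have h₁ : i.1 < s := by omega
      have h₂ : i.1 < s + 1 := by omega
      simp [stageColor, h₁, h₂])

/-- `x (f, …, f)`. -/
def Raw.fillAll {n : ℕ} {v w a : C} {p : ℤ} (f : Raw k G 1 (fun _ => v) w 0)
    (x : Raw k G n (fun _ => w) a p) : Raw k G n (fun _ => v) a p :=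
  (Raw.fill f x n).act 1 (by simp [stageColor])

end FillAll

/-! ### Diagrams of algebras -/

/-- A subdiagram: a subcategory. -/
structure Subdiagram (S : Type u) [SmallCategory S] where
  obj : Set S
  hom : ∀ {v w : S}, Set (v ⟶ w)
  source_mem : ∀ {v w : S} {f : v ⟶ w}, f ∈ hom → v ∈ obj
  target_mem : ∀ {v w : S} {f : v ⟶ w}, f ∈ hom → w ∈ obj
  id_mem : ∀ {v : S}, v ∈ obj → 𝟙 v ∈ hom
  comp_mem : ∀ {v w z : S} {f : v ⟶ w} {g : w ⟶ z}, f ∈ hom → g ∈ hom → f ≫ g ∈ hom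

/-- The whole diagram. -/
def Subdiagram.whole (S : Type u) [SmallCategory S] : Subdiagram S where
  obj := Set.univ
  hom := Set.univ
  source_mem _ := trivial
  target_mem _ := trivial
  id_mem _ := trivial
  comp_mem _ _ := trivial

section Diagram

variable {k : Type u} [Field k] {S : Type u} [SmallCategory S] (P : GrOperad k Unit)
  (D : Subdiagram S)

/-- A graft of operations of `P`, with all inputs and outputs placed at the vertex `v`. -/
def Graft.atVertex {m n l : ℕ} {c : Fin m → Unit} {b : Fin n → Unit} {a' : Unit} {e : Fin l → Unit}
    (g : Graft c b a' e) (v : S) :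
    Graft (fun _ : Fin m => v) (fun _ : Fin n => v) v (fun _ : Fin l => v) where
  slot := g.slot
  slot_color := rfl
  num := g.num
  num_color := by rintro (_ | _) <;> rfl

/-- The generators of the operad of `(S, D)`-diagrams of `P`-algebras: the operations of `P` at each
vertex of `D`, and the arrows of `S`. -/
inductive DiagramGen : (n : ℕ) → (Fin n → S) → S → ℤ → Type u
  | op {n : ℕ} {p : ℤ} (v : S) (hv : v ∈ D.obj) (x : P.obj n (fun _ => ()) () p) :
      DiagramGen n (fun _ => v) v p
  | arr {v w : S} (f : v ⟶ w) : DiagramGen 1 (fun _ => v) w 0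

variable {P D} in
/-- An operation of `P` at a vertex of `D`, as a formal expression. -/
abbrev Raw.op {n : ℕ} {p : ℤ} (v : S) (hv : v ∈ D.obj) (x : P.obj n (fun _ => ()) () p) :
    Raw k (DiagramGen P D) n (fun _ => v) v p :=
  .gen (.op v hv x)

/-- An arrow of `S`, as a formal expression. -/
abbrev Raw.arr {v w : S} (f : v ⟶ w) : Raw k (DiagramGen P D) 1 (fun _ => v) w 0 :=
  .gen (.arr f)

/-- The relations of the operad of `(S, D)`-diagrams of `P`-algebras: the structure of `P` at each
vertex of `D`, the commutativity relations of `S`, and, for each arrow `f` of `D` and each operation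
`x` of `P`, the relation `f x = x (f, …, f)`. -/
inductive DiagramRel : ∀ (n : ℕ) (c : Fin n → S) (a : S) (p : ℤ),
    Raw k (DiagramGen P D) n c a p → Raw k (DiagramGen P D) n c a p → Prop
  | op_add {n : ℕ} {p : ℤ} (v : S) (hv : v ∈ D.obj) (x y : P.obj n (fun _ => ()) () p) :
      DiagramRel n _ v p (.op v hv (x + y)) (.add (.op v hv x) (.op v hv y))
  | op_smul {n : ℕ} {p : ℤ} (v : S) (hv : v ∈ D.obj) (r : k) (x : P.obj n (fun _ => ()) () p) :
      DiagramRel n _ v p (.op v hv (r • x)) (.smul r (.op v hv x))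
  | op_act {n : ℕ} {p : ℤ} (v : S) (hv : v ∈ D.obj) (σ : Equiv.Perm (Fin n))
      (x : P.obj n (fun _ => ()) () p) :
      DiagramRel n _ v p (.op v hv (P.act σ (fun _ => rfl) x))
        (.act σ (fun _ => rfl) (.op v hv x))
  | op_unit (v : S) (hv : v ∈ D.obj) :
      DiagramRel 1 _ v 0 (.op v hv (P.unit ())) (.unit v)
  | op_comp {m n l : ℕ} {p q r : ℤ} (v : S) (hv : v ∈ D.obj)
      (g : Graft (fun _ : Fin m => ()) (fun _ : Fin n => ()) () (fun _ : Fin l => ()))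
      (hr : p + q = r) (x : P.obj m (fun _ => ()) () p) (y : P.obj n (fun _ => ()) () q) :
      DiagramRel l _ v r (.op v hv (P.comp g hr x y))
        (.comp (g.atVertex v) hr (.op v hv x) (.op v hv y))
  | arr_id (v : S) : DiagramRel 1 _ v 0 (.arr P D (𝟙 v)) (.unit v)
  | arr_comp {v w z : S} (f : v ⟶ w) (f' : w ⟶ z)
      (g : Graft (fun _ : Fin 1 => w) (fun _ : Fin 1 => v) w (fun _ : Fin 1 => v)) :
      DiagramRel 1 _ z 0 (.arr P D (f ≫ f')) (.comp g (add_zero 0) (.arr P D f') (.arr P D f))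
  | arr_op {v w : S} (f : v ⟶ w) (hf : f ∈ D.hom) {n : ℕ} {p : ℤ}
      (x : P.obj n (fun _ => ()) () p)
      (g : Graft (fun _ : Fin 1 => v) (fun _ : Fin n => v) v (fun _ : Fin n => v))
      (hg : ∀ t, g.inner t = t) :
      DiagramRel n _ w p (.comp g (zero_add p) (.arr P D f) (.op v (D.source_mem hf) x))
        (Raw.fillAll (.arr P D f) (.op w (D.target_mem hf) x))

/-- The operad `P_(S, D)` of `(S, D)`-diagrams of `P`-algebras: `S`-diagrams of graded vector spaces
with a `P`-algebra structure at each vertex of `D` such that the arrows of `D` are homomorphisms.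
Its colors are the vertices of `S`. -/
def diagramOperad : GrOperad k S := presentedOperad (DiagramRel P D)

/-- The generators of `P_(S, D)` in `P_(S, S)`. -/
def DiagramGen.forget (n : ℕ) (c : Fin n → S) (a : S) (p : ℤ) :
    DiagramGen P D n c a p → DiagramGen P (Subdiagram.whole S) n c a p
  | .op v _ x => .op v trivial x
  | .arr f => .arr f

theorem eval_fill (X : GrOperad k S) {n : ℕ} {v w a : S} {p : ℤ}
    (γ : ∀ (n : ℕ) (c : Fin n → S) (a : S) (p : ℤ), DiagramGen P D n c a p → X.obj n c a p)
    {D' : Subdiagram S}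
    (γ' : ∀ (n : ℕ) (c : Fin n → S) (a : S) (p : ℤ), DiagramGen P D' n c a p → X.obj n c a p)
    (f : Raw k (DiagramGen P D) 1 (fun _ => v) w 0) (x : Raw k (DiagramGen P D) n (fun _ => w) a p)
    (f' : Raw k (DiagramGen P D') 1 (fun _ => v) w 0)
    (x' : Raw k (DiagramGen P D') n (fun _ => w) a p)
    (hf : f.eval X γ = f'.eval X γ') (hx : x.eval X γ = x'.eval X γ') (s : ℕ) :
    (Raw.fill f x s).eval X γ = (Raw.fill f' x' s).eval X γ' := by
  induction s with
  | zero => simp only [Raw.fill, Raw.eval, hx]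
  | succ s ih =>
    by_cases h : s < n
    · simp only [Raw.fill, h, dite_true, Raw.eval, ih, hf]
    · simp only [Raw.fill, h, dite_false, Raw.eval, ih]

theorem eval_mk {n : ℕ} {c : Fin n → S} {a : S} {p : ℤ} (x : Raw k (DiagramGen P D) n c a p) :
    x.eval (diagramOperad P D) (fun _ _ _ _ y => PresentedObj.mk (.gen y)) = PresentedObj.mk x := by
  induction x with
  | gen => rfl
  | unit => rfl
  | zero => rfl
  | add x y ihx ihy => simp only [Raw.eval, ihx, ihy]; rfl
  | smul r x ih => simp only [Raw.eval, ih]; rfl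
  | act σ h x ih => simp only [Raw.eval, ih]; rfl
  | comp g hr x y ihx ihy => simp only [Raw.eval, ihx, ihy]; rfl

/-- The canonical map `P_(S, D) → P_(S, S)`, sending each generator to the generator of the same
name. -/
def canonicalMap : GrOperad.Hom (diagramOperad P D) (diagramOperad P (Subdiagram.whole S)) :=
  presentedOperad.lift (DiagramRel P D) (diagramOperad P (Subdiagram.whole S))
    (fun n c a p x => PresentedObj.mk (.gen (DiagramGen.forget P D n c a p x)))
    (by
      intro n c a p x y h
      cases h with
      | op_add _ _ x y =>
        exact PresentedObj.sound
          (.of (DiagramRel.op_add (D := Subdiagram.whole S) _ (Set.mem_univ _) x y))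
      | op_smul _ _ r x =>
        exact PresentedObj.sound
          (.of (DiagramRel.op_smul (D := Subdiagram.whole S) _ (Set.mem_univ _) r x))
      | op_act _ _ σ x =>
        exact PresentedObj.sound
          (.of (DiagramRel.op_act (D := Subdiagram.whole S) _ (Set.mem_univ _) σ x))
      | op_unit _ _ =>
        exact PresentedObj.sound
          (.of (DiagramRel.op_unit (D := Subdiagram.whole S) _ (Set.mem_univ _)))
      | op_comp _ _ g hr x y =>
        exact PresentedObj.sound
          (.of (DiagramRel.op_comp (D := Subdiagram.whole S) _ (Set.mem_univ _) g hr x y))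
      | arr_id _ => exact PresentedObj.sound (.of (.arr_id _))
      | arr_comp f f' g => exact PresentedObj.sound (.of (.arr_comp f f' g))
      | arr_op f hf x g hg =>
        have key := PresentedObj.sound (.of (DiagramRel.arr_op (P := P)
          (D := Subdiagram.whole S) f trivial x g hg))
        rw [← eval_mk P (Subdiagram.whole S) (Raw.fillAll _ _)] at key
        refine Eq.trans key ?_
        simp only [Raw.fillAll, Raw.eval]
        congr 1
        refine eval_fill P (Subdiagram.whole S) (diagramOperad P (Subdiagram.whole S)) _ _ _ _ _ _
          ?_ ?_ _ <;> rfl)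

/-- The classical extension property: the canonical map `P_(S, D) → P_S` has a left inverse. -/
def HasExtensionProperty : Prop :=
  ∃ ψ : GrOperad.Hom (diagramOperad P (Subdiagram.whole S)) (diagramOperad P D),
    ψ.comp (canonicalMap P D) = GrOperad.Hom.id (diagramOperad P D)

/-- A commutative square
```
  R_(S,D) ---ι---> R_S
    |               |
  P_(S,D) ---φ---> P_S
```
of colored dg-operads, in which the vertical maps are cofibrant resolutions, `ι` is a cofibration
and `φ` is the canonical map. -/
structure ResolutionSquare where
  /-- the operad `R_(S,D)` -/
  source : DGOperad k S
  /-- the operad `R_S` -/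
  target : DGOperad k S
  source_cofibrant : source.IsElementallyCofibrant
  target_cofibrant : target.IsElementallyCofibrant
  sourceMap : DGOperad.Hom source (diagramOperad P D).toDG
  targetMap : DGOperad.Hom target (diagramOperad P (Subdiagram.whole S)).toDG
  sourceMap_iso : sourceMap.IsHomologyIso
  targetMap_iso : targetMap.IsHomologyIso
  ι : DGOperad.Hom source target
  ι_cofibration : ι.IsElementalCofibration
  comm : targetMap.comp ι = (canonicalMap P D).toDG.comp sourceMap

variable {P D} in
/-- The homotopy extension property, with respect to a choice of resolutions: `ι` has a left
inverse. -/
def ResolutionSquare.HasHomotopyExtensionProperty (Q : ResolutionSquare P D) : Prop :=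
  ∃ ρ : DGOperad.Hom Q.target Q.source, ρ.comp Q.ι = DGOperad.Hom.id Q.source

end Diagram

/-! Both operads at the bottom of the square have zero differential, so each is the homology of the
resolution above it, and the vertical maps are surjective already on cycles. The two implications
are a descent to homology and a lifting against the left vertical map.

From homotopy to classical: given a left inverse `ρ` of `ι`, the morphism `Q.sourceMap.comp ρ` has a
target with zero differential, so it kills boundaries. Hence on cycles it factors through
`Q.targetMap` (`exists_descent`), giving `ψ`. An element of the lower left operad is the image of a
cycle `z`, and the square together with `ρ (ι z) = z` gives `ψ ∘ φ = id`.

From classical to homotopy: given `ψ`, the identity of `Q.source` and `ψ ∘ Q.targetMap` form a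
commutative square from `ι` to `Q.sourceMap`, because `ψ ∘ φ = id`. A diagonal filler is the
required left inverse. It exists by `exists_lift`: `Q.sourceMap` is a surjective homology
isomorphism and `ι` is a cofibration.

The filler is built one collection `E i` after the other. For a generator `e`, its value must have a
prescribed boundary and a prescribed image. Such a value exists for each `e` by a diagram chase, but
the chosen values must also form a linear equivariant map. This is where characteristic zero enters:
linearity comes from a basis, equivariance from averaging over the symmetric group
(`exists_equivariant_lift`). -/

/-! ### Equivariant solutions of linear equations by averaging. -/

section Averaging

variable {k : Type u} [Field k] {C : Type w}

/-- The zero morphism of collections. -/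
def GrCollection.Hom.zero (E F : GrCollection k C) : GrCollection.Hom E F where
  app := 0
  app_act σ h x := by simp

/-- Over a field of characteristic zero, a linear equation with equivariant coefficients that is
solvable in each component has an equivariant linear solution. -/
theorem GrCollection.exists_equivariant_lift [CharZero k] (E F : GrCollection k C)
    (good : ∀ {n : ℕ} {c : Fin n → C} {a : C} {p : ℤ}, E.obj n c a p → F.obj n c a p → Prop)
    (good_add : ∀ {n : ℕ} {c : Fin n → C} {a : C} {p : ℤ} (x x' : E.obj n c a p)
      (y y' : F.obj n c a p), good x y → good x' y' → good (x + x') (y + y'))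
    (good_smul : ∀ {n : ℕ} {c : Fin n → C} {a : C} {p : ℤ} (r : k) (x : E.obj n c a p)
      (y : F.obj n c a p), good x y → good (r • x) (r • y))
    (good_act : ∀ {n : ℕ} {c c' : Fin n → C} {a : C} {p : ℤ} (σ : Equiv.Perm (Fin n))
      (h : ∀ i, c' i = c (σ i)) (x : E.obj n c a p) (y : F.obj n c a p),
      good x y → good (E.act σ h x) (F.act σ h y))
    (solve : ∀ {n : ℕ} {c : Fin n → C} {a : C} {p : ℤ} (x : E.obj n c a p), ∃ y, good x y) :
    ∃ f : GrCollection.Hom E F, ∀ {n : ℕ} {c : Fin n → C} {a : C} {p : ℤ} (x : E.obj n c a p),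
      good x (f.app x) := by
  have zero_good : ∀ {n : ℕ} {c : Fin n → C} {a : C} {p : ℤ},
      good (0 : E.obj n c a p) (0 : F.obj n c a p) := by
    intro n c a p
    obtain ⟨y, hy⟩ := solve (0 : E.obj n c a p)
    simpa using good_smul 0 _ _ hy
  -- Linearity first, one component at a time: solutions chosen on a basis extend linearly, and
  -- `good` is closed under linear combinations.
  have lin : ∀ (n : ℕ) (c : Fin n → C) (a : C) (p : ℤ),
      ∃ L : E.obj n c a p →ₗ[k] F.obj n c a p, ∀ x, good x (L x) := by
    intro n c a p
    let b := Module.Basis.ofVectorSpace k (E.obj n c a p)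
    choose s hs using fun i => solve (b i)
    refine ⟨b.constr k s, fun x => ?_⟩
    induction b.mem_span x using Submodule.span_induction with
    | mem x hx => obtain ⟨i, rfl⟩ := hx; rw [b.constr_basis]; exact hs i
    | zero => simpa using zero_good
    | add x y _ _ hx hy => rw [map_add]; exact good_add _ _ _ _ hx hy
    | smul r x _ hx => rw [map_smul]; exact good_smul _ _ _ hx
  choose L hL using lin
  have inv_color : ∀ {n : ℕ} (c : Fin n → C) (σ : Equiv.Perm (Fin n)),
      ∀ i, c i = (fun j => c (σ j)) (σ⁻¹ i) := by intro n c σ i; simp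
  -- The average of `σ⁻¹ ∘ L ∘ σ` over the whole symmetric group. A permutation may change the input
  -- colors, so each summand uses the `L` of the component with colors `c ∘ σ` and then returns to
  -- the component of `c`.
  refine ⟨{ app := fun {n} {c} {a} {p} => ((n.factorial : k)⁻¹) • ∑ σ : Equiv.Perm (Fin n),
              F.act σ⁻¹ (inv_color c σ) ∘ₗ L n (fun j => c (σ j)) a p ∘ₗ E.act σ (fun _ => rfl)
            app_act := ?_ }, fun {n} {c} {a} {p} x => ?_⟩
  · intro n c c' a p τ h x
    obtain rfl : c' = fun i => c (τ i) := funext h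
    simp only [LinearMap.smul_apply, LinearMap.sum_apply, LinearMap.comp_apply, map_smul, map_sum]
    congr 1
    -- Substituting `τ * σ` for `σ` in the sum matches the two sides term by term, since `(τ * σ)⁻¹
    -- * τ = σ⁻¹`.
    rw [← Equiv.sum_comp (Equiv.mulLeft τ) (fun σ => F.act τ h (F.act σ⁻¹ (inv_color c σ)
      (L n (fun j => c (σ j)) a p (E.act σ (fun _ => rfl) x))))]
    refine Finset.sum_congr rfl fun σ _ => ?_
    change F.act σ⁻¹ _ (L n (fun j => c ((τ * σ) j)) a p (E.act σ _ (E.act τ h x))) =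
      F.act τ h (F.act (τ * σ)⁻¹ _
        (L n (fun j => c ((τ * σ) j)) a p (E.act (τ * σ) (fun _ => rfl) x)))
    -- The color condition in `act` depends on the permutation, so equal permutations are exchanged
    -- by substitution rather than by rewriting.
    have key : ∀ (ρ : Equiv.Perm (Fin n)) (_ : ρ = σ⁻¹)
        (h₁ : ∀ i, c (τ i) = (fun j => c ((τ * σ) j)) (ρ i)) (z : F.obj n (fun j => c ((τ * σ) j)) a p),
        F.act σ⁻¹ (inv_color (fun i => c (τ i)) σ) z = F.act ρ h₁ z := by
      rintro _ rfl _ _; rfl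
    refine Eq.trans ?_ (F.act_mul (τ * σ)⁻¹ τ _ h (by intro i; simp) _).symm
    refine (key _ (by group) _ _).trans (congrArg _ (congrArg _ ?_))
    exact E.act_mul τ σ _ _ _ x
  -- Each summand is a solution for `σ⁻¹ (σ x) = x`, so the sum over `s` solves for `s.card • x`;
  -- over the whole group this is `n! • x`, and `n!` is invertible.
  · have sum_good : ∀ s : Finset (Equiv.Perm (Fin n)),
        good ((s.card : k) • x) (∑ σ ∈ s, F.act σ⁻¹ (inv_color c σ)
          (L n (fun j => c (σ j)) a p (E.act σ (fun _ => rfl) x))) := by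
      intro s
      induction s using Finset.induction_on with
      | empty => simpa using zero_good
      | insert σ s hσ ih =>
        rw [Finset.card_insert_of_notMem hσ, Finset.sum_insert hσ, Nat.cast_succ, add_smul,
          one_smul, add_comm]
        refine good_add _ _ _ _ ?_ ih
        have := good_act σ⁻¹ (inv_color c σ) _ _ (hL n (fun j => c (σ j)) a p
          (E.act σ (fun _ => rfl) x))
        rw [E.act_mul σ σ⁻¹ _ _ (by intro i; simp)] at this
        have key : ∀ (ρ : Equiv.Perm (Fin n)) (_ : ρ = 1) (h₁ : ∀ i, c i = c (ρ i)),
            E.act ρ h₁ x = x := by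
          rintro _ rfl h₁; exact E.act_one h₁ x
        rwa [key _ (by group)] at this
    have h0 : (n.factorial : k) ≠ 0 := Nat.cast_ne_zero.2 n.factorial_ne_zero
    have := good_smul ((n.factorial : k)⁻¹) _ _ (sum_good Finset.univ)
    rw [Finset.card_univ, Fintype.card_perm, Fintype.card_fin, inv_smul_smul₀ h0] at this
    simpa only [LinearMap.smul_apply, LinearMap.sum_apply, LinearMap.comp_apply] using this

end Averaging

/-! ### Generated suboperads, and what can be checked on generators. -/

section Suboperad

variable {k : Type u} [Field k] {C : Type w} (P : GrOperad k C)
  (T : ∀ (n : ℕ) (c : Fin n → C) (a : C) (p : ℤ), Set (P.obj n c a p))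

/-- The generated elements of given arity, colors and degree, as a subspace. -/
def GrOperad.generatedSubmodule (n : ℕ) (c : Fin n → C) (a : C) (p : ℤ) :
    Submodule k (P.obj n c a p) where
  carrier := {x | P.Generated T x}
  add_mem' hx hy := .add _ _ hx hy
  zero_mem' := .zero
  smul_mem' r _ hx := .smul r _ hx

/-- The suboperad generated by `T`, as an operad. -/
def GrOperad.suboperad : GrOperad k C where
  obj n c a p := P.generatedSubmodule T n c a p
  act σ h := (P.act σ h).restrict fun x hx => .act σ h x hx
  act_one h x := Subtype.ext (P.act_one h x.1)
  act_mul σ τ h h' h'' x := Subtype.ext (P.act_mul σ τ h h' h'' x.1)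
  unit a := ⟨P.unit a, .unit a⟩
  comp g hr := LinearMap.mk₂ k
    (fun x y => ⟨P.comp g hr x.1 y.1, .comp g hr x.1 y.1 x.2 y.2⟩)
    (fun x x' y => Subtype.ext (by simp))
    (fun r x y => Subtype.ext (by simp))
    (fun x y y' => Subtype.ext (by simp))
    (fun r x y => Subtype.ext (by simp))
  act_comp σ h g g' hg hr x y := Subtype.ext (P.act_comp σ h g g' hg hr x.1 y.1)
  comp_act_left σ h g g' hg hr x y := Subtype.ext (P.comp_act_left σ h g g' hg hr x.1 y.1)
  comp_act_right σ h g g' hg hr x y := Subtype.ext (P.comp_act_right σ h g g' hg hr x.1 y.1)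
  unit_comp g hg hr y := Subtype.ext (P.unit_comp g hg hr y.1)
  comp_unit g hg hg' hr x := Subtype.ext (P.comp_unit g hg hg' hr x.1)
  comp_assoc g₁ g₂ g₃ g₄ hg h₁ h₂ h₃ h₄ x y z :=
    Subtype.ext (P.comp_assoc g₁ g₂ g₃ g₄ hg h₁ h₂ h₃ h₄ x.1 y.1 z.1)
  comp_comm g₁ g₂ g₃ g₄ hg h₁ h₂ h₃ h₄ x y z :=
    Subtype.ext (P.comp_comm g₁ g₂ g₃ g₄ hg h₁ h₂ h₃ h₄ x.1 y.1 z.1)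

/-- The inclusion of the suboperad generated by `T`. -/
def GrOperad.suboperadIncl : GrOperad.Hom (P.suboperad T) P where
  app := Submodule.subtype _
  app_act _ _ _ := rfl
  app_unit _ := rfl
  app_comp _ _ _ _ := rfl

variable {P T}

/-- Factorization of a morphism of operads through a suboperad that contains its image. -/
def GrOperad.Hom.codRestrict {S : GrOperad k C} (f : GrOperad.Hom S P)
    (hf : ∀ (n : ℕ) (c : Fin n → C) (a : C) (p : ℤ) (x : S.obj n c a p), f.app x ∈ T n c a p) :
    GrOperad.Hom S (P.suboperad T) where
  app {n c a p} := LinearMap.codRestrict (P.generatedSubmodule T n c a p) f.app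
    fun x => .of _ (hf n c a p x)
  app_act σ h x := Subtype.ext (f.app_act σ h x)
  app_unit a := Subtype.ext (f.app_unit a)
  app_comp g hr x y := Subtype.ext (f.app_comp g hr x y)

/-- Factorization of a morphism of collections through a suboperad that contains its image. -/
def GrCollection.Hom.codRestrict {E : GrCollection k C} (f : GrCollection.Hom E P.toGrCollection)
    (hf : ∀ (n : ℕ) (c : Fin n → C) (a : C) (p : ℤ) (x : E.obj n c a p), f.app x ∈ T n c a p) :
    GrCollection.Hom E (P.suboperad T).toGrCollection where
  app {n c a p} := LinearMap.codRestrict (P.generatedSubmodule T n c a p) f.app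
    fun x => .of _ (hf n c a p x)
  app_act σ h x := Subtype.ext (f.app_act σ h x)

/-- Morphisms of operads that agree on `T` agree on the suboperad generated by `T`. -/
theorem GrOperad.Generated.hom_eq {X : GrOperad k C} {f g : GrOperad.Hom P X}
    (h : ∀ {n : ℕ} {c : Fin n → C} {a : C} {p : ℤ} (x : P.obj n c a p),
      x ∈ T n c a p → f.app x = g.app x)
    {n : ℕ} {c : Fin n → C} {a : C} {p : ℤ} {x : P.obj n c a p} (hx : P.Generated T x) :
    f.app x = g.app x := by
  induction hx with
  | of x hx => exact h x hx
  | unit a => rw [f.app_unit, g.app_unit]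
  | zero => rw [map_zero, map_zero]
  | add x y _ _ hx hy => rw [map_add, map_add, hx, hy]
  | smul r x _ hx => rw [map_smul, map_smul, hx]
  | act σ h x _ hx => rw [f.app_act, g.app_act, hx]
  | comp g' hr x y _ _ hx hy => rw [f.app_comp, g.app_comp, hx, hy]

/-- The unit of a dg-operad is a cycle. -/
theorem DGOperad.d_unit (X : DGOperad k C) (a : C) (q : ℤ) (h : q + 1 = 0) :
    X.d 0 q h (X.unit a) = 0 := by
  let g : Graft (fun _ : Fin 1 => a) (fun _ : Fin 1 => a) a (fun _ : Fin 1 => a) :=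
    { slot := 0
      slot_color := rfl
      num := replaceNum 0
      num_color := by rintro (_ | _) <;> rfl }
  have hin : ∀ t, g.inner t = t := fun t => Subsingleton.elim _ _
  have hout : ∀ j hj, g.outer j hj = j := fun j hj => Subsingleton.elim _ _
  -- The Leibniz rule for `1 ∘ 1 = 1` reads `d 1 = d 1 + d 1`.
  have e := X.d_comp g (zero_add 0) h h h (add_zero q) (zero_add q) (X.unit a) (X.unit a)
  rw [X.unit_comp g hin, X.unit_comp g hin, X.comp_unit g hout (Subsingleton.elim _ _)] at e
  simpa using e

/-- A morphism of operads that commutes with the differential on `T` commutes with the differential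
on the suboperad generated by `T`. -/
theorem GrOperad.Generated.app_d {Q X : DGOperad k C}
    {T : ∀ (n : ℕ) (c : Fin n → C) (a : C) (p : ℤ), Set (Q.obj n c a p)}
    {f : GrOperad.Hom Q.toGrOperad X.toGrOperad}
    (hf : ∀ {n : ℕ} {c : Fin n → C} {a : C} {p : ℤ} (x : Q.obj n c a p), x ∈ T n c a p →
      ∀ q h, f.app (Q.d p q h x) = X.d p q h (f.app x))
    {n : ℕ} {c : Fin n → C} {a : C} {p : ℤ} {x : Q.obj n c a p} (hx : Q.Generated T x)
    (q : ℤ) (h : q + 1 = p) : f.app (Q.d p q h x) = X.d p q h (f.app x) := by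
  induction hx generalizing q with
  | of x hx => exact hf x hx q h
  | unit a => rw [f.app_unit, Q.d_unit, X.d_unit, map_zero]
  | zero => simp only [map_zero]
  | add x y _ _ hx hy => simp only [map_add, hx, hy]
  | smul r x _ hx => simp only [map_smul, hx]
  | act σ hσ x _ hx => rw [Q.d_act, f.app_act, f.app_act, X.d_act, hx]
  | @comp m n l c b e a a' p q' r g hr x y _ _ hx hy =>
    rw [Q.d_comp g hr (sub_add_cancel p 1) (sub_add_cancel q' 1) h (by omega) (by omega),
      f.app_comp,
      X.d_comp g hr (sub_add_cancel p 1) (sub_add_cancel q' 1) h (by omega) (by omega)]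
    rw [map_add, map_smul, f.app_comp, f.app_comp, hx, hy]

end Suboperad

/-! ### Homology isomorphisms in terms of cycles and boundaries. -/

section Homology

variable {k : Type u} [Field k] {C : Type w}

/-- Injectivity on homology, in the form used for diagram chases: the hypothesis `ht` says that the
class of `x` maps to zero. The degrees `q`, `p`, `r` are free variables tied by equations, so that
callers need no casts. -/
theorem DGOperad.Hom.IsHomologyIso.exists_boundary {X Y : DGOperad k C} {α : DGOperad.Hom X Y}
    (hα : α.IsHomologyIso) {n : ℕ} {c : Fin n → C} {a : C} {p q r : ℤ} (h : q + 1 = p)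
    (h' : p + 1 = r) (x : X.obj n c a p) (hx : X.d p q h x = 0) (t : Y.obj n c a r)
    (ht : α.app x = Y.d r p h' t) : ∃ x₀ : X.obj n c a r, X.d r p h' x₀ = x := by
  obtain rfl : q = p - 1 := by omega
  subst h'
  let z : X.cycles n c a p := ⟨x, hx⟩
  have hz : α.homologyMap n c a p (Submodule.Quotient.mk z) = 0 :=
    (Submodule.Quotient.mk_eq_zero _).2 ⟨t, ht.symm⟩
  have := (hα n c a p).1 (hz.trans (map_zero _).symm)
  obtain ⟨x₀, hx₀⟩ := (Submodule.Quotient.mk_eq_zero _).1 this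
  exact ⟨x₀, hx₀⟩

/-- Surjectivity on homology, with the boundary that measures the failure of `α.app x = y` made
explicit. -/
theorem DGOperad.Hom.IsHomologyIso.exists_cycle {X Y : DGOperad k C} {α : DGOperad.Hom X Y}
    (hα : α.IsHomologyIso) {n : ℕ} {c : Fin n → C} {a : C} {p q r : ℤ} (h : q + 1 = p)
    (h' : p + 1 = r) (y : Y.obj n c a p) (hy : Y.d p q h y = 0) :
    ∃ x : X.obj n c a p, X.d p q h x = 0 ∧ ∃ t : Y.obj n c a r, Y.d r p h' t = α.app x - y := by
  obtain rfl : q = p - 1 := by omega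
  subst h'
  obtain ⟨x, hx⟩ := (hα n c a p).2 (Submodule.Quotient.mk ⟨y, hy⟩)
  obtain ⟨z, rfl⟩ := Submodule.Quotient.mk_surjective _ x
  obtain ⟨t, ht⟩ := (Submodule.Quotient.eq _).1 hx
  exact ⟨z.1, z.2, t, ht⟩

/-- A homology isomorphism to an operad with trivial differential is surjective on cycles. -/
theorem DGOperad.Hom.IsHomologyIso.exists_cycle_eq {X : DGOperad k C} {Y : GrOperad k C}
    {α : DGOperad.Hom X Y.toDG} (hα : α.IsHomologyIso) {n : ℕ} {c : Fin n → C} {a : C} {p : ℤ}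
    (y : Y.obj n c a p) : ∃ x : X.obj n c a p,
      X.d p (p - 1) (sub_add_cancel p 1) x = 0 ∧ α.app x = y := by
  obtain ⟨x, hx, t, ht⟩ := hα.exists_cycle (sub_add_cancel p 1) rfl y rfl
  exact ⟨x, hx, (sub_eq_zero.1 ht.symm)⟩

/-- A morphism of dg-operads `γ : X → Z` to an operad with trivial differential descends, on cycles,
along a homology isomorphism `β : X → Y` to an operad with trivial differential. -/
theorem DGOperad.Hom.IsHomologyIso.exists_descent {X : DGOperad k C} {Y Z : GrOperad k C}
    {β : DGOperad.Hom X Y.toDG} (hβ : β.IsHomologyIso) (γ : DGOperad.Hom X Z.toDG) :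
    ∃ ψ : GrOperad.Hom Y Z, ∀ {n : ℕ} {c : Fin n → C} {a : C} {p : ℤ} (x : X.obj n c a p),
      X.d p (p - 1) (sub_add_cancel p 1) x = 0 → ψ.app (β.app x) = γ.app x := by
  -- Two cycles with the same image under `β` differ by a boundary, which `γ` kills because its
  -- target has zero differential.
  have wd : ∀ {n : ℕ} {c : Fin n → C} {a : C} {p : ℤ} (x x' : X.obj n c a p),
      X.d p (p - 1) (sub_add_cancel p 1) x = 0 → X.d p (p - 1) (sub_add_cancel p 1) x' = 0 →
      β.app x = β.app x' → γ.app x = γ.app x' := by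
    intro n c a p x x' hx hx' h
    obtain ⟨t, ht⟩ := hβ.exists_boundary (sub_add_cancel p 1) rfl (x - x')
      (by rw [map_sub, hx, hx', sub_zero]) 0 (by rw [map_sub, h, sub_self, map_zero])
    rw [← sub_eq_zero, ← map_sub, ← ht, γ.app_d]
    rfl
  -- The representatives `s y` are arbitrary and respect no structure. Every axiom for `ψ` follows
  -- from `wd`, since sums, multiples, permutations, units and composites of cycles are again
  -- cycles.
  choose s hs hsβ using fun {n c a p} (y : Y.obj n c a p) => hβ.exists_cycle_eq y
  refine ⟨{ app := fun {n} {c} {a} {p} =>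
              { toFun := fun y => γ.app (s y)
                map_add' := fun y y' =>
                  (wd _ _ (hs _) (by rw [map_add, hs, hs, add_zero])
                    (by rw [map_add, hsβ, hsβ, hsβ]; rfl)).trans (map_add γ.app (s y) (s y'))
                map_smul' := fun r y =>
                  (wd _ _ (hs _) (by rw [map_smul, hs, smul_zero])
                    (by rw [map_smul, hsβ, hsβ]; rfl)).trans (map_smul γ.app r (s y)) }
            app_act := fun σ h y => ?_
            app_unit := fun a => ?_
            app_comp := fun {m n l c b e a a' p q r} g hr y y' => ?_ }, ?_⟩
  · change γ.app (s _) = Z.act σ h (γ.app (s y))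
    refine Eq.trans (wd _ _ (hs _) ?_ ?_) (γ.app_act σ h (s y))
    · rw [X.d_act, hs, map_zero]
    · rw [hsβ, β.app_act, hsβ]; rfl
  · change γ.app (s _) = _
    refine Eq.trans (wd _ _ (hs _) (X.d_unit a _ _) ?_) (γ.app_unit a)
    rw [hsβ, β.app_unit]; rfl
  · change γ.app (s _) = Z.comp g hr (γ.app (s y)) (γ.app (s y'))
    refine Eq.trans (wd _ _ (hs _) ?_ ?_) (γ.app_comp g hr (s y) (s y'))
    · rw [X.d_comp g hr (sub_add_cancel p 1) (sub_add_cancel q 1) _ (by omega) (by omega), hs, hs]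
      simp
    · rw [hsβ, β.app_comp, hsβ, hsβ]; rfl
  · intro n c a p x hx
    exact wd _ _ (hs _) hx (hsβ _)

end Homology

/-! ### Lifting cofibrations against surjective homology isomorphisms. -/

section Lifting

variable {k : Type u} [Field k] {C : Type w}

/-- If `Q` has the universal property of the free product of `S` with the free operad on `⨁ Eᵢ`,
then it is generated by `S` and the `Eᵢ`. -/
theorem GrOperad.generated_of_universal {S Q : GrOperad k C} (ι : GrOperad.Hom S Q)
    {E : ℕ → GrCollection k C} (j : ∀ i, GrCollection.Hom (E i) Q.toGrCollection)
    (univ : ∀ (X : GrOperad k C) (f : GrOperad.Hom S X)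
      (g : ∀ i, GrCollection.Hom (E i) X.toGrCollection),
      ∃! h : GrOperad.Hom Q X, h.comp ι = f ∧
        ∀ (i n : ℕ) (c : Fin n → C) (a : C) (p : ℤ) (x : (E i).obj n c a p),
          h.app ((j i).app x) = (g i).app x)
    {n : ℕ} {c : Fin n → C} {a : C} {p : ℤ} (x : Q.obj n c a p) :
    Q.Generated (fun n c a p => {y | (∃ s : S.obj n c a p, ι.app s = y) ∨
      ∃ i, ∃ z : (E i).obj n c a p, (j i).app z = y}) x := by
  set T : ∀ (n : ℕ) (c : Fin n → C) (a : C) (p : ℤ), Set (Q.obj n c a p) :=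
    fun n c a p => {y | (∃ s : S.obj n c a p, ι.app s = y) ∨
      ∃ i, ∃ z : (E i).obj n c a p, (j i).app z = y}
  -- Retract argument: the universal property maps `Q` to the generated suboperad, and uniqueness
  -- forces the composite with the inclusion to be the identity.
  obtain ⟨r, ⟨hr₁, hr₂⟩, -⟩ := univ (Q.suboperad T)
    (ι.codRestrict fun n c a p s => Or.inl ⟨s, rfl⟩)
    (fun i => (j i).codRestrict fun n c a p z => Or.inr ⟨i, z, rfl⟩)
  have e : (Q.suboperadIncl T).comp r = GrOperad.Hom.id Q := by
    refine (univ Q ι j).unique ⟨?_, ?_⟩ ⟨rfl, fun _ _ _ _ _ _ => rfl⟩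
    · change (Q.suboperadIncl T).comp (r.comp ι) = ι
      rw [hr₁]; rfl
    · intro i n c a p x
      change (Q.suboperadIncl T).app (r.app _) = _
      rw [hr₂]; rfl
  have hx : (r.app x).1 = x := congrArg (fun f : GrOperad.Hom Q Q => f.app x) e
  rw [← hx]
  exact (r.app x).2

/-- The choice of the components of a lift, one generating collection after the other. -/
noncomputable def stagewise {E : ℕ → GrCollection k C} {F : GrCollection k C}
    (good : ∀ i, (∀ i, GrCollection.Hom (E i) F) → GrCollection.Hom (E i) F → Prop) (i : ℕ) :
    GrCollection.Hom (E i) F :=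
  open Classical in
  let G : ∀ j, GrCollection.Hom (E j) F := fun j =>
    if _ : j < i then stagewise good j else GrCollection.Hom.zero _ _
  if h : ∃ f, good i G f then h.choose else GrCollection.Hom.zero _ _

-- The recursion hands stage `i` the family of earlier choices, padded by zero from `i` on. Its
-- fallback value, used when no good choice exists, is excluded by `h`. The padding is harmless when
-- `good i` depends only on the members of the family below `i`.
open Classical in
theorem stagewise_spec {E : ℕ → GrCollection k C} {F : GrCollection k C}
    (good : ∀ i, (∀ i, GrCollection.Hom (E i) F) → GrCollection.Hom (E i) F → Prop) (i : ℕ)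
    (h : ∃ f, good i (fun j => if j < i then stagewise good j else GrCollection.Hom.zero _ _) f) :
    good i (fun j => if j < i then stagewise good j else GrCollection.Hom.zero _ _)
      (stagewise good i) := by
  have e : stagewise good i = h.choose := by
    rw [stagewise]
    exact dif_pos h
  rw [e]
  exact h.choose_spec

/-- In characteristic zero, elemental cofibrations have the left lifting property with respect to
surjective homology isomorphisms. -/
theorem DGOperad.Hom.IsElementalCofibration.exists_lift [CharZero k] {S Q X Y : DGOperad k C}
    {ι : DGOperad.Hom S Q} (hι : ι.IsElementalCofibration) {α : DGOperad.Hom X Y}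
    (hα : α.IsHomologyIso)
    (hα' : ∀ {n : ℕ} {c : Fin n → C} {a : C} {p : ℤ} (y : Y.obj n c a p),
      ∃ x : X.obj n c a p, α.app x = y)
    (f : DGOperad.Hom S X) (β : DGOperad.Hom Q Y) (comm : β.comp ι = α.comp f) :
    ∃ h : DGOperad.Hom Q X, h.comp ι = f ∧ α.comp h = β := by
  classical
  obtain ⟨E, j, univ, hd⟩ := hι
  -- `H G` is the operad morphism that equals `f` on `S` and `G i` on each `E i`; it need not
  -- commute with differentials.
  choose H hH hH' using fun G => (univ X.toGrOperad f.toOperadHom G).exists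
  have hHι : ∀ G {n : ℕ} {c : Fin n → C} {a : C} {p : ℤ} (s : S.obj n c a p),
      (H G).app (ι.app s) = f.app s := fun G n c a p s =>
    congrArg (fun u : GrOperad.Hom S.toGrOperad X.toGrOperad => u.app s) (hH G)
  have hβι : ∀ {n : ℕ} {c : Fin n → C} {a : C} {p : ℤ} (s : S.obj n c a p),
      β.app (ι.app s) = α.app (f.app s) := fun s =>
    congrArg (fun u : DGOperad.Hom S Y => u.app s) comm
  -- The two demands on the value at a generator `e`: its boundary is `H G (d e)`, and its image
  -- under `α` is `β e`.
  let good : ∀ i, (∀ i, GrCollection.Hom (E i) X.toGrCollection) →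
      GrCollection.Hom (E i) X.toGrCollection → Prop := fun i G g =>
    ∀ ⦃n : ℕ⦄ ⦃c : Fin n → C⦄ ⦃a : C⦄ ⦃p : ℤ⦄ (x : (E i).obj n c a p),
      (∀ q h, X.d p q h (g.app x) = (H G).app (Q.d p q h ((j i).app x))) ∧
        α.app (g.app x) = β.app ((j i).app x)
  let G := stagewise good
  -- The filtration condition: `d e` lies in the suboperad generated by `S` and the stages below
  -- `i`, so zero padding from `i` on does not affect `H G (d e)`.
  have agree : ∀ i {n : ℕ} {c : Fin n → C} {a : C} {p q : ℤ} (h : q + 1 = p)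
      (x : (E i).obj n c a p),
      (H fun j => if j < i then G j else GrCollection.Hom.zero _ _).app (Q.d p q h ((j i).app x)) =
        (H G).app (Q.d p q h ((j i).app x)) := by
    intro i n c a p q h x
    refine GrOperad.Generated.hom_eq ?_ (hd i n c a p q h x)
    rintro n c a p _ (⟨s, rfl⟩ | ⟨i', hi', z, rfl⟩)
    · rw [hHι, hHι]
    · rw [hH', hH', if_pos hi']
  have main : ∀ i, good i G (G i) := by
    intro i
    induction i using Nat.strong_induction_on with
    | _ i ih =>
    suffices ∃ g, good i G g by
      have e : ∀ g, good i (fun j => if j < i then G j else GrCollection.Hom.zero _ _) g ↔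
          good i G g := fun g => by simp only [good, agree]
      exact (e _).1 (stagewise_spec good i (this.imp fun g hg => (e g).2 hg))
    -- Both demands are linear and equivariant in the pair of generator and value, so it suffices to
    -- meet them for one generator at a time.
    refine GrCollection.exists_equivariant_lift (E i) X.toGrCollection
      (fun {n} {c} {a} {p} x y => (∀ q h, X.d p q h y = (H G).app (Q.d p q h ((j i).app x))) ∧
        α.app y = β.app ((j i).app x)) ?_ ?_ ?_ ?_
    · rintro n c a p x x' y y' ⟨h₁, h₂⟩ ⟨h₁', h₂'⟩
      exact ⟨fun q h => by simp only [map_add, h₁, h₁'], by simp only [map_add, h₂, h₂']⟩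
    · rintro n c a p r x y ⟨h₁, h₂⟩
      exact ⟨fun q h => by simp only [map_smul, h₁], by simp only [map_smul, h₂]⟩
    · rintro n c c' a p σ hσ x y ⟨h₁, h₂⟩
      exact ⟨fun q h => by rw [X.d_act, h₁, (j i).app_act, Q.d_act, (H G).app_act],
        by rw [α.app_act, h₂, (j i).app_act, β.app_act]⟩
    · intro n c a p x
      have gen := hd i n c a p (p - 1) (sub_add_cancel p 1) x
      set e := (j i).app x
      set y := (H G).app (Q.d p (p - 1) (sub_add_cancel p 1) e) with hy
      -- By the induction hypothesis `H G` commutes with the differential on `S` and the lower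
      -- stages, hence on `d e`; so `d (H G (d e)) = H G (d (d e)) = 0`.
      have hy₁ : X.d (p - 1) (p - 1 - 1) (sub_add_cancel _ 1) y = 0 := by
        rw [hy, ← gen.app_d (f := H G), Q.d_d, map_zero]
        rintro n c a p _ (⟨s, rfl⟩ | ⟨i', hi', z, rfl⟩) q h
        · rw [← ι.app_d, hHι, hHι, f.app_d]
        · rw [← (ih i' hi' z).1, hH']
      have hy₂ : α.app y = Y.d p (p - 1) (sub_add_cancel p 1) (β.app e) := by
        rw [hy, ← β.app_d]
        refine GrOperad.Generated.hom_eq (f := α.toOperadHom.comp (H G)) (g := β.toOperadHom) ?_ gen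
        rintro n c a p _ (⟨s, rfl⟩ | ⟨i', hi', z, rfl⟩)
        · change α.app ((H G).app _) = _
          rw [hHι, hβι]
        · change α.app ((H G).app _) = _
          rw [hH', (ih i' hi' z).2]
      -- `x₀` has the right boundary, but its image may miss `β e` by a cycle. That cycle is `α z`
      -- up to a boundary `d t`, and surjectivity of `α` lifts `t` to `t'`. The correction `z - d
      -- t'` repairs the image without changing the boundary.
      obtain ⟨x₀, hx₀⟩ := hα.exists_boundary (sub_add_cancel _ 1) (sub_add_cancel p 1) y hy₁ _ hy₂
      obtain ⟨z, hz, t, ht⟩ := hα.exists_cycle (sub_add_cancel p 1) rfl (β.app e - α.app x₀)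
        (by rw [map_sub, ← α.app_d, hx₀, hy₂, sub_self])
      obtain ⟨t', rfl⟩ := hα' t
      refine ⟨x₀ + z - X.d (p + 1) p rfl t', ?_, ?_⟩
      · intro q h
        obtain rfl : q = p - 1 := by omega
        rw [map_sub, map_add, hx₀, hz, X.d_d, add_zero, sub_zero]
      · rw [map_sub, map_add, α.app_d, ht]
        abel
  have gen := fun {n c a p} (x : Q.obj n c a p) =>
    GrOperad.generated_of_universal ι.toOperadHom j univ x
  refine ⟨{ toOperadHom := H G, app_d := fun p q h x => ?_ }, ?_, ?_⟩
  · refine (gen x).app_d ?_ q h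
    rintro n c a p _ (⟨s, rfl⟩ | ⟨i, z, rfl⟩) q h
    · rw [← ι.app_d, hHι, hHι, f.app_d]
    · rw [← (main i z).1, hH']
  · ext n c a p s
    exact hHι G s
  · ext n c a p x
    refine GrOperad.Generated.hom_eq (f := α.toOperadHom.comp (H G)) (g := β.toOperadHom) ?_ (gen x)
    rintro n c a p _ (⟨s, rfl⟩ | ⟨i, z, rfl⟩)
    · change α.app ((H G).app (ι.app s)) = β.app (ι.app s)
      rw [hHι, hβι]
    · change α.app ((H G).app _) = _
      rw [hH', (main i z).2]

end Lifting

/-! ### Comparison of the two extension properties. -/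

theorem theorem3 {k : Type u} [Field k] [CharZero k] {S : Type u} [SmallCategory S] [FinCategory S]
    (P : GrOperad k Unit) (D : Subdiagram S) (Q : ResolutionSquare P D) :
    Q.HasHomotopyExtensionProperty ↔ HasExtensionProperty P D := by
  have comm : ∀ {n : ℕ} {c : Fin n → S} {a : S} {p : ℤ} (z : Q.source.obj n c a p),
      Q.targetMap.app (Q.ι.app z) = (canonicalMap P D).app (Q.sourceMap.app z) := fun z =>
    congrArg (fun f : DGOperad.Hom _ _ => f.app z) Q.comm
  constructor
  · rintro ⟨ρ, hρ⟩
    obtain ⟨ψ, hψ⟩ := Q.targetMap_iso.exists_descent (Q.sourceMap.comp ρ)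
    refine ⟨ψ, ?_⟩
    ext n c a p x
    obtain ⟨z, hz, rfl⟩ := Q.sourceMap_iso.exists_cycle_eq x
    change ψ.app ((canonicalMap P D).app (Q.sourceMap.app z)) = Q.sourceMap.app z
    have e : ρ.app (Q.ι.app z) = z := congrArg (fun f : DGOperad.Hom _ _ => f.app z) hρ
    rw [← comm]
    refine (hψ _ (by rw [← Q.ι.app_d, hz, map_zero])).trans ?_
    change Q.sourceMap.app (ρ.app (Q.ι.app z)) = _
    rw [e]
  · rintro ⟨ψ, hψ⟩
    -- Only the upper triangle of the filled square is needed: it says that `ρ` is a left inverse of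
    -- `ι`. Surjectivity of `Q.sourceMap` holds because every element below it is a cycle.
    obtain ⟨ρ, hρ, -⟩ := Q.ι_cofibration.exists_lift Q.sourceMap_iso
      (fun y => (Q.sourceMap_iso.exists_cycle_eq y).imp fun _ h => h.2)
      (DGOperad.Hom.id Q.source) (ψ.toDG.comp Q.targetMap) (by
        ext n c a p z
        change ψ.app (Q.targetMap.app (Q.ι.app z)) = Q.sourceMap.app z
        rw [comm]
        exact congrArg (fun f : GrOperad.Hom _ _ => f.app (Q.sourceMap.app z)) hψ)
    exact ⟨ρ, hρ⟩
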